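/- Let $\mathcal C$ be a category with finite limits, with a choice of finite products ($1$ denotes the terminal object). **Definitions.** * $\mathrm{Span}(\mathcal C)$ is the symmetric monoidal category with the objects of $\mathcal C$, whose morphisms $A\to B$ are isomorphism classes of spans $A\leftarrow E\to B$ in $\mathcal C$, composed by pullback; the tensor product is the cartesian product of $\mathcal C$, applied to spans componentwise. * For a symmetric monoidal category $(\mathcal D,\otimes,I)$, $\mathrm{St}(\mathcal D)$ is the symmetric monoidal category with the objects of $\mathcal D$, whose morphisms $A\to B$ are pairs $(S\mid f)$ with $S$ an object of $\mathcal D$ and $f:S\otimes A\to S\otimes B$, where $(S\mid f)$ and $(T\mid g)$ are identified if there is an isomorphism $h:S\cong T$ with $g=(h^{-1}\otimes 1)\,;f\,;(h\otimes 1)$. Writing $;$ for composition in diagrammatic order, $\sigma$ for symmetries, and omitting associators and unitors, the identity is $(I\mid 1)$, and $$(S\mid f);(T\mid g)=(S\otimes T\mid (\sigma\otimes 1);(1\otimes f);(\sigma\otimes 1);(1\otimes g)),$$ $$(S\mid f)\otimes(T\mid g)=(S\otimes T\mid (1\otimes\sigma\otimes 1);(f\otimes g);(1\otimes\sigma\otimes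 1)).$$ The inclusion $\mathcal D\to\mathrm{St}(\mathcal D)$ is the identity on objects and sends $u$ to $(I\mid 1\otimes u)$; it is a symmetric strict monoidal functor. For a morphism $(S\mid f):T\otimes A\to T\otimes B$ of $\mathrm{St}(\mathcal D)$ put $\mathrm{store}_T(S\mid f)=(S\otimes T\mid f):A\to B$. * A *feedback operator* on a symmetric monoidal category assigns to every $f:S\otimes A\to S\otimes B$ a morphism $\mathrm{fbk}_S(f):A\to B$ such that: $u;\mathrm{fbk}_S(f);v=\mathrm{fbk}_S((1\otimes u);f;(1\otimes v))$ (tightening); $\mathrm{fbk}_I(f)=f$ (vanishing); $\mathrm{fbk}_T(\mathrm{fbk}_S(f))=\mathrm{fbk}_{S\otimes T}(f)$ (joining); $\mathrm{fbk}_S(f)\otimes g=\mathrm{fbk}_S(f\otimes g)$ (strength); $\mathrm{fbk}_T(f;(h\otimes 1))=\mathrm{fbk}_S((h\otimes 1);f)$ for $f:T\otimes A\to S\otimes B$ and every isomorphism $h:S\cong T$ (sliding). A *feedback category* is a symmetric monoidal category with a feedback operator; a *feedback functor* is a symmetric strong monoidal functor $F$ with $F(\mathrm{fbk}_S(f))=\mathrm{fbk}_{FS}(\mu;Ff;\mu^{-1})$,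 where $\mu$ are the structure isomorphisms of $F$. A feedback category $\mathcal E$ with a symmetric strong monoidal functor $\iota:\mathcal D\to\mathcal E$ is the *free feedback category* over $\mathcal D$ if every symmetric strong monoidal functor $F$ from $\mathcal D$ to a feedback category $\mathcal X$ equals $G\circ\iota$ (as symmetric strong monoidal functors) for a unique feedback functor $G:\mathcal E\to\mathcal X$. * $\mathrm{Graph}(\mathcal C)$ is the category of internal graphs $E\rightrightarrows V$ in $\mathcal C$, that is, of functors $(\bullet\rightrightarrows\bullet)\to\mathcal C$; it has finite limits, computed pointwise. $\mathrm{Span}(\mathrm{Graph}(\mathcal C))_*$ is the full subcategory of $\mathrm{Span}(\mathrm{Graph}(\mathcal C))$ on the graphs of the form $A\rightrightarrows 1$. **Theorem.** 1. There is an isomorphism of categories $K:\mathrm{St}(\mathrm{Span}(\mathcal C))\cong\mathrm{Span}(\mathrm{Graph}(\mathcal C))_*$: a functor that is full, faithful and bijective on objects, with $K(A)=(A\rightrightarrows 1)$ for every object $A$; and the composite of $K$ with the inclusion into $\mathrm{Span}(\mathrm{Graph}(\mathcal C))$ is a symmetric strong monoidal functor. 2. The operator $\mathrm{store}$ is a feedback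 operator on $\mathrm{St}(\mathrm{Span}(\mathcal C))$, and with it $\mathrm{St}(\mathrm{Span}(\mathcal C))$ is the free feedback category over $\mathrm{Span}(\mathcal C)$, along the inclusion $\mathrm{Span}(\mathcal C)\to\mathrm{St}(\mathrm{Span}(\mathcal C))$. Hence the free feedback category over $\mathrm{Span}(\mathcal C)$ is equivalent to the full subcategory of $\mathrm{Span}(\mathrm{Graph}(\mathcal C))$ given by the single-vertex graphs. -/

import Mathlib

open CategoryTheory MonoidalCategory CartesianMonoidalCategory Limits

universe v u v₁ v₂ v₃ u₁ u₂ u₃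

/-! ### The symmetric monoidal category of spans

`SpanCat C` has the objects of `C`; its morphisms are isomorphism classes of spans, composed by
pullback. The tensor product is the componentwise cartesian product. The cartesian monoidal
structure on `C` is a choice of finite products. -/

/-- Objects of `Span(C)`: a copy of the objects of `C`. -/
structure SpanCat (C : Type u) where
  obj : C

namespace SpanCat

section
variable {C : Type u} [Category.{v} C]

/-- Spans from `A` to `B`: no condition is put on the legs. -/
abbrev Spn (A B : C) : Type (max u v) :=
  CategoryTheory.Span (⊤ : MorphismProperty C) (⊤ : MorphismProperty C) A B

theorem hom_inv_apex {A B : C} {S T : Spn A B} (e : S ≅ T) : e.hom.hom ≫ e.inv.hom = 𝟙 S.apex :=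
  congrArg CategoryTheory.Span.Hom.hom e.hom_inv_id

theorem inv_hom_apex {A B : C} {S T : Spn A B} (e : S ≅ T) : e.inv.hom ≫ e.hom.hom = 𝟙 T.apex :=
  congrArg CategoryTheory.Span.Hom.hom e.inv_hom_id

/-- The span `A ⟵ E ⟶ B` with legs `l` and `r`. -/
def spn {A B : C} (E : C) (l : E ⟶ A) (r : E ⟶ B) : Spn A B := ⟨E, l, r, trivial, trivial⟩

variable [HasPullbacks C]

theorem comp_congr {A B D : C} {S S' : Spn A B} {T T' : Spn B D} (e : S ≅ S') (e' : T ≅ T') :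
    Nonempty (S.comp T ≅ S'.comp T') := by
  have h : IsPullback (pullback.fst S.r T.l ≫ e.hom.hom) (pullback.snd S.r T.l ≫ e'.hom.hom)
      S'.r T'.l :=
    (IsPullback.of_hasPullback S.r T.l).of_iso (Iso.refl _)
      ⟨e.hom.hom, e.inv.hom, hom_inv_apex e, inv_hom_apex e⟩
      ⟨e'.hom.hom, e'.inv.hom, hom_inv_apex e', inv_hom_apex e'⟩ (Iso.refl _)
      (by simp) (by simp) (by simp) (by simp)
  have hl : h.isoPullback.hom ≫ pullback.fst S'.r T'.l ≫ S'.l = pullback.fst S.r T.l ≫ S.l := by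
    rw [h.isoPullback_hom_fst_assoc]; simp
  have hr : h.isoPullback.hom ≫ pullback.snd S'.r T'.l ≫ T'.r = pullback.snd S.r T.l ≫ T.r := by
    rw [h.isoPullback_hom_snd_assoc]; simp
  exact ⟨CategoryTheory.Span.mkIso h.isoPullback hl hr⟩

noncomputable instance : CategoryStruct (SpanCat C) where
  Hom X Y := Quotient (isIsomorphicSetoid (Spn X.obj Y.obj))
  id X := Quotient.mk _ (CategoryTheory.Span.id X.obj)
  comp := Quotient.map₂ CategoryTheory.Span.comp (by
    rintro S S' ⟨e⟩ T T' ⟨e'⟩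
    exact comp_congr e e')

variable {X Y Z W : SpanCat C}

/-- The morphism of `Span(C)` represented by a span. -/
def homMk (E : C) (l : E ⟶ X.obj) (r : E ⟶ Y.obj) : X ⟶ Y := Quotient.mk _ (spn E l r)

theorem hom_ind {motive : (X ⟶ Y) → Prop}
    (h : ∀ (E : C) (l : E ⟶ X.obj) (r : E ⟶ Y.obj), motive (homMk E l r)) (q : X ⟶ Y) :
    motive q :=
  Quotient.ind (fun P => h P.apex P.l P.r) q

theorem homMk_eq {E E' : C} {l : E ⟶ X.obj} {r : E ⟶ Y.obj} {l' : E' ⟶ X.obj} {r' : E' ⟶ Y.obj}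
    (e : E ≅ E') (hl : e.hom ≫ l' = l) (hr : e.hom ≫ r' = r) :
    (homMk E l r : X ⟶ Y) = homMk E' l' r' :=
  Quotient.sound ⟨CategoryTheory.Span.mkIso e hl hr⟩

theorem id_def (X : SpanCat C) : 𝟙 X = homMk X.obj (𝟙 _) (𝟙 _) := rfl

theorem homMk_comp {E F P : C} {l : E ⟶ X.obj} {r : E ⟶ Y.obj} {l' : F ⟶ Y.obj} {r' : F ⟶ Z.obj}
    {p : P ⟶ E} {q : P ⟶ F} (h : IsPullback p q r l') :
    (homMk E l r : X ⟶ Y) ≫ (homMk F l' r' : Y ⟶ Z) = homMk P (p ≫ l) (q ≫ r') := by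
  symm
  exact homMk_eq h.isoPullback (by simp [spn]) (by simp [spn])

/-- A morphism of the base, as a span whose left leg is an identity. -/
def graphHom (u : X.obj ⟶ Y.obj) : X ⟶ Y := homMk X.obj (𝟙 _) u

theorem homMk_graphHom {E : C} (l : E ⟶ X.obj) (r : E ⟶ Y.obj) (u : Y.obj ⟶ Z.obj) :
    (homMk E l r : X ⟶ Y) ≫ (graphHom u : Y ⟶ Z) = homMk E l (r ≫ u) := by
  rw [graphHom, homMk_comp (p := 𝟙 E) (q := r) (.of_horiz_isIso ⟨by simp⟩)]
  simp

theorem graphHom_homMk (u : X.obj ≅ Y.obj) {E : C} (l : E ⟶ Y.obj) (r : E ⟶ Z.obj) :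
    (graphHom u.hom : X ⟶ Y) ≫ (homMk E l r : Y ⟶ Z) = homMk E (l ≫ u.inv) r := by
  rw [graphHom, homMk_comp (p := l ≫ u.inv) (q := 𝟙 E) (.of_vert_isIso ⟨by simp⟩)]
  simp

theorem graphHom_id (X : SpanCat C) : graphHom (𝟙 X.obj) = 𝟙 X := rfl

theorem graphHom_comp (u : X.obj ⟶ Y.obj) (v : Y.obj ⟶ Z.obj) :
    (graphHom (u ≫ v) : X ⟶ Z) = (graphHom u : X ⟶ Y) ≫ graphHom v := by
  rw [graphHom, graphHom, homMk_graphHom]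

noncomputable instance : Category (SpanCat C) where
  id_comp {X Y} f := by
    induction f using hom_ind with
    | h E l r =>
      refine (graphHom_homMk (X := X) (Iso.refl X.obj) l r).trans ?_
      simp
  comp_id {X Y} f := by
    induction f using hom_ind with
    | h E l r => rw [← graphHom_id, homMk_graphHom, Category.comp_id]
  assoc {X Y Z W} f g h := by
    induction f using hom_ind with
    | h E l r => induction g using hom_ind with
      | h F l' r' => induction h using hom_ind with
        | h G l'' r'' =>
          have h₁ := IsPullback.of_hasPullback r l'
          have h₂ := IsPullback.of_hasPullback r' l''
          have h₃ := IsPullback.of_hasPullback (pullback.snd r l') (pullback.fst r' l'')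
          rw [homMk_comp h₁, homMk_comp h₂, homMk_comp (h₃.paste_vert h₂),
            homMk_comp (h₃.flip.paste_vert h₁.flip).flip]
          simp

/-- An isomorphism of the base, as an isomorphism in the category of spans. -/
@[simps]
noncomputable def graphIso (u : X.obj ≅ Y.obj) : X ≅ Y where
  hom := graphHom u.hom
  inv := graphHom u.inv
  hom_inv_id := by rw [← graphHom_comp, Iso.hom_inv_id, graphHom_id]
  inv_hom_id := by rw [← graphHom_comp, Iso.inv_hom_id, graphHom_id]

end

section
variable {C : Type u} [Category.{v} C] [CartesianMonoidalCategory C]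

/-- A product of pullback squares is a pullback square. -/
theorem isPullback_tensor {P E F B P' E' F' B' : C} {p : P ⟶ E} {q : P ⟶ F} {r : E ⟶ B} {l : F ⟶ B}
    {p' : P' ⟶ E'} {q' : P' ⟶ F'} {r' : E' ⟶ B'} {l' : F' ⟶ B'} (h : IsPullback p q r l)
    (h' : IsPullback p' q' r' l') :
    IsPullback (p ⊗ₘ p') (q ⊗ₘ q') (r ⊗ₘ r') (l ⊗ₘ l') := by
  refine ⟨⟨by simp [h.w, h'.w]⟩, ⟨PullbackCone.IsLimit.mk _
    (fun s => lift
      (h.lift (s.fst ≫ fst _ _) (s.snd ≫ fst _ _)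
        (by simpa using s.condition =≫ fst _ _))
      (h'.lift (s.fst ≫ snd _ _) (s.snd ≫ snd _ _)
        (by simpa using s.condition =≫ snd _ _))) ?_ ?_ ?_⟩⟩
  · intro s
    ext <;> simp
  · intro s
    ext <;> simp
  · intro s m hm hm'
    ext
    · apply h.hom_ext <;> simp [← hm, ← hm']
    · apply h'.hom_ext <;> simp [← hm, ← hm']

end

section
variable {C : Type u} [Category.{v} C] [HasPullbacks C] [CartesianMonoidalCategory C]

/-- Parallel composition: the componentwise product of spans. -/
def tensorMap {X Y X' Y' : SpanCat C} : (X ⟶ Y) → (X' ⟶ Y') →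
    ((⟨X.obj ⊗ X'.obj⟩ : SpanCat C) ⟶ ⟨Y.obj ⊗ Y'.obj⟩) :=
  Quotient.map₂ (fun S T => spn (S.apex ⊗ T.apex) (S.l ⊗ₘ T.l) (S.r ⊗ₘ T.r)) (by
    rintro S S' ⟨e⟩ T T' ⟨e'⟩
    refine ⟨CategoryTheory.Span.mkIso ⟨e.hom.hom ⊗ₘ e'.hom.hom, e.inv.hom ⊗ₘ e'.inv.hom, ?_, ?_⟩
      ?_ ?_⟩
    · change (e.hom.hom ⊗ₘ e'.hom.hom) ≫ (e.inv.hom ⊗ₘ e'.inv.hom) = 𝟙 (S.apex ⊗ T.apex)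
      simp [hom_inv_apex]
    · change (e.inv.hom ⊗ₘ e'.inv.hom) ≫ (e.hom.hom ⊗ₘ e'.hom.hom) = 𝟙 (S'.apex ⊗ T'.apex)
      simp [inv_hom_apex]
    · simp [spn]
    · simp [spn])

noncomputable instance : MonoidalCategoryStruct (SpanCat C) where
  tensorObj X Y := ⟨X.obj ⊗ Y.obj⟩
  tensorHom := tensorMap
  whiskerLeft X _ _ f := tensorMap (𝟙 X) f
  whiskerRight f Y := tensorMap f (𝟙 Y)
  tensorUnit := ⟨𝟙_ C⟩
  associator X Y Z := graphIso (X := ⟨(X.obj ⊗ Y.obj) ⊗ Z.obj⟩) (α_ X.obj Y.obj Z.obj)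
  leftUnitor X := graphIso (X := ⟨𝟙_ C ⊗ X.obj⟩) (λ_ X.obj)
  rightUnitor X := graphIso (X := ⟨X.obj ⊗ 𝟙_ C⟩) (ρ_ X.obj)

variable {X Y Z W X' Y' : SpanCat C}

theorem homMk_tensorHom {E E' : C} (l : E ⟶ X.obj) (r : E ⟶ Y.obj)
    (l' : E' ⟶ X'.obj) (r' : E' ⟶ Y'.obj) :
    (homMk E l r : X ⟶ Y) ⊗ₘ (homMk E' l' r' : X' ⟶ Y') =
      homMk (X := X ⊗ X') (Y := Y ⊗ Y') (E ⊗ E') (l ⊗ₘ l') (r ⊗ₘ r') := rfl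

theorem graphHom_tensorHom (u : X.obj ⟶ Y.obj) (v : X'.obj ⟶ Y'.obj) :
    (graphHom u : X ⟶ Y) ⊗ₘ (graphHom v : X' ⟶ Y') =
      graphHom (X := X ⊗ X') (Y := Y ⊗ Y') (u ⊗ₘ v) := by
  rw [graphHom, graphHom, homMk_tensorHom, id_tensorHom_id]
  rfl

noncomputable instance : MonoidalCategory (SpanCat C) := MonoidalCategory.ofTensorHom
  (id_tensorHom_id := fun X Y => by
    rw [← graphHom_id, ← graphHom_id, graphHom_tensorHom, id_tensorHom_id]
    exact graphHom_id (X ⊗ Y))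
  (id_tensorHom := fun _ _ _ _ => rfl)
  (tensorHom_id := fun _ _ => rfl)
  (tensorHom_comp_tensorHom := fun {X₁ Y₁ Z₁ X₂ Y₂ Z₂} f f' g g' => by
    induction f using hom_ind with
    | h E l r => induction g using hom_ind with
      | h F k s => induction f' using hom_ind with
        | h E' l' r' => induction g' using hom_ind with
          | h F' k' s' =>
            have h := IsPullback.of_hasPullback r k
            have h' := IsPullback.of_hasPullback r' k'
            rw [homMk_tensorHom, homMk_tensorHom, homMk_comp h, homMk_comp h', homMk_tensorHom]
            refine (homMk_comp (X := X₁ ⊗ X₂) (Y := Y₁ ⊗ Y₂) (Z := Z₁ ⊗ Z₂)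
              (isPullback_tensor h h')).trans ?_
            rw [tensorHom_comp_tensorHom, tensorHom_comp_tensorHom])
  (associator_naturality := fun {X₁ X₂ X₃ Y₁ Y₂ Y₃} f g h => by
    induction f using hom_ind with
    | h E l r => induction g using hom_ind with
      | h F l' r' => induction h using hom_ind with
        | h G l'' r'' =>
          refine (homMk_graphHom (X := (X₁ ⊗ X₂) ⊗ X₃) (Y := (Y₁ ⊗ Y₂) ⊗ Y₃) (Z := Y₁ ⊗ Y₂ ⊗ Y₃)
            _ _ _).trans (Eq.trans ?_ (graphHom_homMk (X := (X₁ ⊗ X₂) ⊗ X₃) (Y := X₁ ⊗ X₂ ⊗ X₃)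
              (Z := Y₁ ⊗ Y₂ ⊗ Y₃) (α_ X₁.obj X₂.obj X₃.obj) _ _).symm)
          exact homMk_eq (X := (X₁ ⊗ X₂) ⊗ X₃) (Y := Y₁ ⊗ Y₂ ⊗ Y₃)
            (l := (l ⊗ₘ l') ⊗ₘ l'') (r := ((r ⊗ₘ r') ⊗ₘ r'') ≫ (α_ _ _ _).hom)
            (l' := (l ⊗ₘ l' ⊗ₘ l'') ≫ (α_ _ _ _).inv) (r' := r ⊗ₘ r' ⊗ₘ r'')
            (α_ E F G) (by simp) (by simp))
  (leftUnitor_naturality := fun {X Y} f => by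
    induction f using hom_ind with
    | h E l r =>
      refine (homMk_graphHom (X := 𝟙_ (SpanCat C) ⊗ X) (Y := 𝟙_ (SpanCat C) ⊗ Y) (Z := Y)
        _ _ _).trans (Eq.trans ?_ (graphHom_homMk (X := 𝟙_ (SpanCat C) ⊗ X) (Y := X) (Z := Y)
          (λ_ X.obj) _ _).symm)
      exact homMk_eq (X := 𝟙_ (SpanCat C) ⊗ X) (Y := Y)
        (l := 𝟙 (𝟙_ C) ⊗ₘ l) (r := (𝟙 (𝟙_ C) ⊗ₘ r) ≫ (λ_ Y.obj).hom)
        (λ_ E) (by simp) (by simp))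
  (rightUnitor_naturality := fun {X Y} f => by
    induction f using hom_ind with
    | h E l r =>
      refine (homMk_graphHom (X := X ⊗ 𝟙_ (SpanCat C)) (Y := Y ⊗ 𝟙_ (SpanCat C)) (Z := Y)
        _ _ _).trans (Eq.trans ?_ (graphHom_homMk (X := X ⊗ 𝟙_ (SpanCat C)) (Y := X) (Z := Y)
          (ρ_ X.obj) _ _).symm)
      exact homMk_eq (X := X ⊗ 𝟙_ (SpanCat C)) (Y := Y)
        (l := l ⊗ₘ 𝟙 (𝟙_ C)) (r := (r ⊗ₘ 𝟙 (𝟙_ C)) ≫ (ρ_ Y.obj).hom)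
        (ρ_ E) (by simp) (by simp))
  (pentagon := fun W X Y Z => by
    have h := congrArg (graphHom (X := ((W ⊗ X) ⊗ Y) ⊗ Z) (Y := W ⊗ X ⊗ Y ⊗ Z))
      (MonoidalCategory.pentagon W.obj X.obj Y.obj Z.obj)
    rw [← MonoidalCategory.tensorHom_id, ← MonoidalCategory.id_tensorHom] at h
    rw [graphHom_comp (Y := (W ⊗ X ⊗ Y) ⊗ Z), graphHom_comp (Y := W ⊗ (X ⊗ Y) ⊗ Z),
      graphHom_comp (Y := (W ⊗ X) ⊗ Y ⊗ Z)] at h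
    have e₁ := graphHom_tensorHom (X := (W ⊗ X) ⊗ Y) (Y := W ⊗ X ⊗ Y) (X' := Z) (Y' := Z)
      (α_ W.obj X.obj Y.obj).hom (𝟙 Z.obj)
    have e₂ := graphHom_tensorHom (X := W) (Y := W) (X' := (X ⊗ Y) ⊗ Z) (Y' := X ⊗ Y ⊗ Z)
      (𝟙 W.obj) (α_ X.obj Y.obj Z.obj).hom
    exact (congrArg₂ (fun a b => a ≫ (α_ W (X ⊗ Y) Z).hom ≫ b) e₁ e₂).trans h)
  (triangle := fun X Y => by
    have h := congrArg (graphHom (X := (X ⊗ 𝟙_ _) ⊗ Y) (Y := X ⊗ Y))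
      (MonoidalCategory.triangle X.obj Y.obj)
    rw [← MonoidalCategory.tensorHom_id, ← MonoidalCategory.id_tensorHom,
      graphHom_comp (Y := X ⊗ 𝟙_ _ ⊗ Y)] at h
    have e₁ := graphHom_tensorHom (X := X ⊗ 𝟙_ _) (Y := X) (X' := Y) (Y' := Y)
      (ρ_ X.obj).hom (𝟙 Y.obj)
    have e₂ := graphHom_tensorHom (X := X) (Y := X) (X' := 𝟙_ _ ⊗ Y) (Y' := Y)
      (𝟙 X.obj) (λ_ Y.obj).hom
    exact ((congrArg (fun b => (α_ X (𝟙_ (SpanCat C)) Y).hom ≫ b) e₂).trans h).trans e₁.symm)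

theorem whiskerLeft_graphHom (X : SpanCat C) (u : Y.obj ⟶ Z.obj) :
    X ◁ (graphHom u : Y ⟶ Z) = graphHom (X := X ⊗ Y) (Y := X ⊗ Z) (X.obj ◁ u) := by
  rw [← MonoidalCategory.id_tensorHom, ← graphHom_id, graphHom_tensorHom,
    MonoidalCategory.id_tensorHom]

theorem graphHom_whiskerRight (u : Y.obj ⟶ Z.obj) (X : SpanCat C) :
    (graphHom u : Y ⟶ Z) ▷ X = graphHom (X := Y ⊗ X) (Y := Z ⊗ X) (u ▷ X.obj) := by
  rw [← MonoidalCategory.tensorHom_id, ← graphHom_id, graphHom_tensorHom,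
    MonoidalCategory.tensorHom_id]

/-- The exchange of factors of a product. -/
@[simps]
def swap (A B : C) : A ⊗ B ≅ B ⊗ A where
  hom := lift (snd A B) (fst A B)
  inv := lift (snd B A) (fst B A)

theorem tensorHom_swap (f : X ⟶ Y) (g : X' ⟶ Y') :
    (f ⊗ₘ g) ≫ graphHom (X := Y ⊗ Y') (Y := Y' ⊗ Y) (swap Y.obj Y'.obj).hom =
      graphHom (X := X ⊗ X') (Y := X' ⊗ X) (swap X.obj X'.obj).hom ≫ (g ⊗ₘ f) := by
  induction f using hom_ind with
  | h E l r => induction g using hom_ind with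
    | h F l' r' =>
      refine (homMk_graphHom (X := X ⊗ X') (Y := Y ⊗ Y') (Z := Y' ⊗ Y) _ _ _).trans
        (Eq.trans ?_ (graphHom_homMk (X := X ⊗ X') (Y := X' ⊗ X) (Z := Y' ⊗ Y)
          (swap X.obj X'.obj) _ _).symm)
      have hl : (swap E F).hom ≫ (l' ⊗ₘ l) ≫ (swap X.obj X'.obj).inv = l ⊗ₘ l' := by ext <;> simp
      have hr : (swap E F).hom ≫ (r' ⊗ₘ r) = (r ⊗ₘ r') ≫ (swap Y.obj Y'.obj).hom := by
        ext <;> simp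
      exact homMk_eq (X := X ⊗ X') (Y := Y' ⊗ Y) (swap E F) hl hr

noncomputable instance : SymmetricCategory (SpanCat C) where
  braiding X Y := graphIso (X := X ⊗ Y) (Y := Y ⊗ X) (swap X.obj Y.obj)
  braiding_naturality_right X Y Z f := by
    rw [← MonoidalCategory.id_tensorHom, ← MonoidalCategory.tensorHom_id]
    exact tensorHom_swap _ _
  braiding_naturality_left f Z := by
    rw [← MonoidalCategory.id_tensorHom, ← MonoidalCategory.tensorHom_id]
    exact tensorHom_swap _ _
  hexagon_forward X Y Z := by
    have h := congrArg (graphHom (X := (X ⊗ Y) ⊗ Z) (Y := Y ⊗ Z ⊗ X))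
      (show (α_ X.obj Y.obj Z.obj).hom ≫ (swap X.obj (Y.obj ⊗ Z.obj)).hom ≫
        (α_ Y.obj Z.obj X.obj).hom = (swap X.obj Y.obj).hom ▷ Z.obj ≫ (α_ Y.obj X.obj Z.obj).hom ≫
          Y.obj ◁ (swap X.obj Z.obj).hom by ext <;> simp)
    rw [graphHom_comp (Y := X ⊗ Y ⊗ Z), graphHom_comp (Y := (Y ⊗ Z) ⊗ X),
      graphHom_comp (Y := (Y ⊗ X) ⊗ Z), graphHom_comp (Y := Y ⊗ X ⊗ Z)] at h
    have e₁ := graphHom_whiskerRight (Y := X ⊗ Y) (Z := Y ⊗ X) (swap X.obj Y.obj).hom Z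
    have e₂ := whiskerLeft_graphHom Y (Y := X ⊗ Z) (Z := Z ⊗ X) (swap X.obj Z.obj).hom
    exact h.trans (congrArg₂ (fun a b => a ≫ (α_ Y X Z).hom ≫ b) e₁ e₂).symm
  hexagon_reverse X Y Z := by
    have h := congrArg (graphHom (X := X ⊗ Y ⊗ Z) (Y := (Z ⊗ X) ⊗ Y))
      (show (α_ X.obj Y.obj Z.obj).inv ≫ (swap (X.obj ⊗ Y.obj) Z.obj).hom ≫
        (α_ Z.obj X.obj Y.obj).inv = X.obj ◁ (swap Y.obj Z.obj).hom ≫ (α_ X.obj Z.obj Y.obj).inv ≫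
          (swap X.obj Z.obj).hom ▷ Y.obj by ext <;> simp)
    rw [graphHom_comp (Y := (X ⊗ Y) ⊗ Z), graphHom_comp (Y := Z ⊗ X ⊗ Y),
      graphHom_comp (Y := X ⊗ Z ⊗ Y), graphHom_comp (Y := (X ⊗ Z) ⊗ Y)] at h
    have e₁ := whiskerLeft_graphHom X (Y := Y ⊗ Z) (Z := Z ⊗ Y) (swap Y.obj Z.obj).hom
    have e₂ := graphHom_whiskerRight (Y := X ⊗ Z) (Z := Z ⊗ X) (swap X.obj Z.obj).hom Y
    exact h.trans (congrArg₂ (fun a b => a ≫ (α_ X Z Y).inv ≫ b) e₁ e₂).symm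
  symmetry X Y := (graphIso (X := X ⊗ Y) (Y := Y ⊗ X) (swap X.obj Y.obj)).hom_inv_id

end
end SpanCat

/-! ### The category of stateful processes over a symmetric monoidal category -/

/-- A stateful process `(S ∣ f)` from `A` to `B`: a state space `S` and `f : S ⊗ A ⟶ S ⊗ B`. -/
structure StProc (D : Type u) [Category.{v} D] [MonoidalCategory D] (A B : D) where
  state : D
  hom : state ⊗ A ⟶ state ⊗ B

namespace StProc

section
variable {D : Type u} [Category.{v} D] [MonoidalCategory D] {A B C A' B' : D}

/-- Stateful processes are identified along isomorphisms of their state spaces. -/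
def Rel (P Q : StProc D A B) : Prop :=
  ∃ h : P.state ≅ Q.state, Q.hom = h.inv ▷ A ≫ P.hom ≫ h.hom ▷ B

instance setoid (A B : D) : Setoid (StProc D A B) where
  r := Rel
  iseqv := by
    refine ⟨fun P => ⟨Iso.refl _, by simp⟩, ?_, ?_⟩
    · rintro P Q ⟨h, e⟩
      exact ⟨h.symm, by rw [e]; simp⟩
    · rintro P Q R ⟨h, e⟩ ⟨k, e'⟩
      exact ⟨h ≪≫ k, by rw [e', e]; simp⟩

theorem equiv_mk {S T : D} {f : S ⊗ A ⟶ S ⊗ B} {g : T ⊗ A ⟶ T ⊗ B} (h : S ≅ T)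
    (e : f ≫ h.hom ▷ B = h.hom ▷ A ≫ g) : (⟨S, f⟩ : StProc D A B) ≈ ⟨T, g⟩ :=
  ⟨h, by dsimp only; rw [e]; simp⟩

theorem exists_iso {S T : D} {f : S ⊗ A ⟶ S ⊗ B} {g : T ⊗ A ⟶ T ⊗ B}
    (e : (⟨S, f⟩ : StProc D A B) ≈ ⟨T, g⟩) :
    ∃ h : S ≅ T, f ≫ h.hom ▷ B = h.hom ▷ A ≫ g := by
  obtain ⟨h, e⟩ := e
  dsimp only at h e
  exact ⟨h, by rw [e]; simp⟩

/-- The action of `f` on the tensor factor `S` of `P ≅ X ⊗ S`. -/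
def place {P X S A B : D} (σ : P ≅ X ⊗ S) (f : S ⊗ A ⟶ S ⊗ B) : P ⊗ A ⟶ P ⊗ B :=
  σ.hom ▷ A ≫ (α_ X S A).hom ≫ X ◁ f ≫ (α_ X S B).inv ≫ σ.inv ▷ B

theorem place_comp {P X S A B C : D} (σ : P ≅ X ⊗ S) (f : S ⊗ A ⟶ S ⊗ B) (g : S ⊗ B ⟶ S ⊗ C) :
    place σ (f ≫ g) = place σ f ≫ place σ g := by
  simp [place]

theorem place_conj {P P' X S A B : D} (h : P' ≅ P) (σ : P ≅ X ⊗ S) (f : S ⊗ A ⟶ S ⊗ B) :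
    h.hom ▷ A ≫ place σ f = place (h ≪≫ σ) f ≫ h.hom ▷ B := by
  simp [place]

theorem place_tail {P X X' S S' A B : D} (σ : P ≅ X ⊗ S) (x : X ≅ X') (k : S ≅ S')
    {f : S ⊗ A ⟶ S ⊗ B} {f' : S' ⊗ A ⟶ S' ⊗ B} (e : f ≫ k.hom ▷ B = k.hom ▷ A ≫ f') :
    place (σ ≪≫ (x ⊗ᵢ k)) f' = place σ f := by
  have e2 : f' = k.inv ▷ A ≫ f ≫ k.hom ▷ B := by rw [e]; simp
  subst e2
  simp only [place, Iso.trans_hom, tensorIso_hom, Iso.trans_inv, tensorIso_inv,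
    comp_whiskerRight, Category.assoc, MonoidalCategory.tensorHom_def', whiskerLeft_comp,
    associator_naturality_left_assoc, associator_naturality_middle_assoc,
    associator_inv_naturality_middle_assoc]
  have c1 : X' ◁ k.hom ▷ A ≫ X' ◁ k.inv ▷ A = 𝟙 _ := by simp
  have c2 : (X' ◁ k.hom) ▷ B ≫ (X' ◁ k.inv) ▷ B = 𝟙 _ := by simp
  rw [whisker_exchange_assoc, reassoc_of% c1, reassoc_of% c2, ← whisker_exchange_assoc,
    associator_inv_naturality_left_assoc, ← comp_whiskerRight_assoc (x.hom ▷ S),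
    ← comp_whiskerRight x.hom, Iso.hom_inv_id]
  simp

theorem place_place {P Q X Y S A B : D} (τ : P ≅ Y ⊗ Q) (σ : Q ≅ X ⊗ S) (f : S ⊗ A ⟶ S ⊗ B) :
    place τ (place σ f) =
      place (τ ≪≫ whiskerLeftIso Y σ ≪≫ (α_ Y X S).symm) f := by
  simp [place]

end

section
variable {D : Type u} [Category.{v} D] [MonoidalCategory D] [SymmetricCategory D]
  {A B C E A' B' C' : D}

/-- Sequential composition `(σ ⊗ 1) ≫ (1 ⊗ f) ≫ (σ ⊗ 1) ≫ (1 ⊗ g)`, with associators. -/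
def compHom {S T : D} (f : S ⊗ A ⟶ S ⊗ B) (g : T ⊗ B ⟶ T ⊗ C) : (S ⊗ T) ⊗ A ⟶ (S ⊗ T) ⊗ C :=
  (β_ S T).hom ▷ A ≫ (α_ T S A).hom ≫ T ◁ f ≫ (α_ T S B).inv ≫
    (β_ T S).hom ▷ B ≫ (α_ S T B).hom ≫ S ◁ g ≫ (α_ S T C).inv

/-- Parallel composition `(1 ⊗ σ ⊗ 1) ≫ (f ⊗ g) ≫ (1 ⊗ σ ⊗ 1)`, with associators. -/
def tensorProc {S T : D} (f : S ⊗ A ⟶ S ⊗ B) (g : T ⊗ A' ⟶ T ⊗ B') :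
    (S ⊗ T) ⊗ (A ⊗ A') ⟶ (S ⊗ T) ⊗ (B ⊗ B') :=
  tensorμ S T A A' ≫ (f ⊗ₘ g) ≫ tensorδ S T B B'

theorem compHom_eq {S T : D} (f : S ⊗ A ⟶ S ⊗ B) (g : T ⊗ B ⟶ T ⊗ C) :
    compHom f g = place (β_ S T) f ≫ place (Iso.refl _) g := by
  simp [compHom, place, SymmetricCategory.braiding_swap_eq_inv_braiding S T]

theorem compHom_congr {S T S' T' : D} {f : S ⊗ A ⟶ S ⊗ B} {g : T ⊗ B ⟶ T ⊗ C}
    {f' : S' ⊗ A ⟶ S' ⊗ B} {g' : T' ⊗ B ⟶ T' ⊗ C} (h : S ≅ S') (k : T ≅ T')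
    (e : f ≫ h.hom ▷ B = h.hom ▷ A ≫ f') (e' : g ≫ k.hom ▷ C = k.hom ▷ B ≫ g') :
    compHom f g ≫ (h ⊗ᵢ k).hom ▷ C = (h ⊗ᵢ k).hom ▷ A ≫ compHom f' g' := by
  have e1 : (h ⊗ᵢ k) ≪≫ β_ S' T' = β_ S T ≪≫ (k ⊗ᵢ h) := by
    ext; simp
  have e2 : (h ⊗ᵢ k) ≪≫ Iso.refl _ = Iso.refl _ ≪≫ (h ⊗ᵢ k) := by ext; simp
  rw [compHom_eq, compHom_eq, reassoc_of% place_conj,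
    place_conj, e1, e2, place_tail _ _ _ e, place_tail _ _ _ e', Category.assoc]

theorem compHom_assoc {S T U : D} (f : S ⊗ A ⟶ S ⊗ B) (g : T ⊗ B ⟶ T ⊗ C) (h : U ⊗ C ⟶ U ⊗ E) :
    compHom (compHom f g) h ≫ (α_ S T U).hom ▷ E =
      (α_ S T U).hom ▷ A ≫ compHom f (compHom g h) := by
  have k : ∀ {S X Y : D} (f : S ⊗ X ⟶ S ⊗ Y),
      f ≫ (Iso.refl S).hom ▷ Y = (Iso.refl S).hom ▷ X ≫ f := by intros; simp
  rw [compHom_eq, compHom_eq, compHom_eq f, compHom_eq g, place_comp, place_comp, place_place,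
    place_place, place_place, place_place, reassoc_of% place_conj, reassoc_of% place_conj, place_conj]
  simp only [← Category.assoc]
  congr 3
  · rw [← place_tail _ (β_ T U) (Iso.refl _) (k f)]
    congr 1
    ext
    rw [← cancel_mono (α_ U T S).hom, ← cancel_epi (α_ S T U).inv]
    simp [← BraidedCategory.yang_baxter]
  · rw [← place_tail _ (β_ S U) (Iso.refl _) (k g)]
    congr 1
    ext
    simp
  · congr 1
    ext
    simp

theorem tensorProc_congr {S T S' T' : D} {f : S ⊗ A ⟶ S ⊗ B} {g : T ⊗ A' ⟶ T ⊗ B'}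
    {f' : S' ⊗ A ⟶ S' ⊗ B} {g' : T' ⊗ A' ⟶ T' ⊗ B'} (h : S ≅ S') (k : T ≅ T')
    (e : f ≫ h.hom ▷ B = h.hom ▷ A ≫ f') (e' : g ≫ k.hom ▷ B' = k.hom ▷ A' ≫ g') :
    tensorProc f g ≫ (h ⊗ᵢ k).hom ▷ (B ⊗ B') = (h ⊗ᵢ k).hom ▷ (A ⊗ A') ≫ tensorProc f' g' := by
  have h1 := tensorμ_natural_left h.hom k.hom A A'
  have h2 : tensorδ S T B B' ≫ (h.hom ⊗ₘ k.hom) ▷ (B ⊗ B') =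
      (h.hom ▷ B ⊗ₘ k.hom ▷ B') ≫ tensorδ S' T' B B' := by
    have := tensorμ_natural_left h.hom k.hom B B' =≫ tensorδ S' T' B B'
    rw [Category.assoc, Category.assoc, tensorμ_tensorδ, Category.comp_id] at this
    rw [this]; simp
  simp only [tensorProc, tensorIso_hom, Category.assoc]
  rw [h2, reassoc_of% h1, tensorHom_comp_tensorHom_assoc, tensorHom_comp_tensorHom_assoc, e, e']

theorem pure_compHom {S : D} (u : A ⟶ B) (f : S ⊗ B ⟶ S ⊗ C) :
    compHom (𝟙_ D ◁ u) f ≫ (λ_ S).hom ▷ C = (λ_ S).hom ▷ A ≫ S ◁ u ≫ f := by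
  simp [compHom]

theorem compHom_pure {S : D} (f : S ⊗ A ⟶ S ⊗ B) (u : B ⟶ C) :
    compHom f (𝟙_ D ◁ u) ≫ (ρ_ S).hom ▷ C = (ρ_ S).hom ▷ A ≫ f ≫ S ◁ u := by
  simp [compHom]

theorem braiding_tensorμ (X₁ X₂ Y₁ Y₂ : D) :
    (β_ (X₁ ⊗ X₂) (Y₁ ⊗ Y₂)).hom ≫ tensorμ Y₁ Y₂ X₁ X₂ =
      tensorμ X₁ X₂ Y₁ Y₂ ≫ ((β_ X₁ Y₁).hom ⊗ₘ (β_ X₂ Y₂).hom) := by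
  have hs : ∀ X Y Z W : D, X ◁ (β_ Y Z).hom ▷ W ≫ X ◁ (β_ Z Y).hom ▷ W = 𝟙 _ := by
    intro X Y Z W
    simp [← whiskerLeft_comp, ← comp_whiskerRight]
  rw [MonoidalCategory.tensorHom_def]
  simp [tensorμ, reassoc_of% hs]

theorem tensorμ_braiding (X₁ X₂ Y₁ Y₂ : D) :
    tensorμ X₁ X₂ Y₁ Y₂ ≫ (β_ (X₁ ⊗ Y₁) (X₂ ⊗ Y₂)).hom =
      ((β_ X₁ X₂).hom ⊗ₘ (β_ Y₁ Y₂).hom) ≫ tensorμ X₂ X₁ Y₂ Y₁ := by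
  have hs : ∀ X Y Z W : D, X ◁ (β_ Y Z).hom ▷ W ≫ X ◁ (β_ Z Y).hom ▷ W = 𝟙 _ := by
    intro X Y Z W
    simp [← whiskerLeft_comp, ← comp_whiskerRight]
  rw [MonoidalCategory.tensorHom_def]
  simp [tensorμ, reassoc_of% hs]

/-- The middle exchange, as an isomorphism. -/
@[simps]
def tensorμIso (X₁ X₂ Y₁ Y₂ : D) : (X₁ ⊗ X₂) ⊗ Y₁ ⊗ Y₂ ≅ (X₁ ⊗ Y₁) ⊗ X₂ ⊗ Y₂ where
  hom := tensorμ X₁ X₂ Y₁ Y₂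
  inv := tensorδ X₁ X₂ Y₁ Y₂

theorem tensorProc_compHom {S T S' T' : D} (f : S ⊗ A ⟶ S ⊗ B) (g : T ⊗ B ⟶ T ⊗ C)
    (f' : S' ⊗ A' ⟶ S' ⊗ B') (g' : T' ⊗ B' ⟶ T' ⊗ C') :
    compHom (tensorProc f f') (tensorProc g g') ≫ (tensorμIso S S' T T').hom ▷ (C ⊗ C') =
      (tensorμIso S S' T T').hom ▷ (A ⊗ A') ≫ tensorProc (compHom f g) (compHom f' g') := by
  have hβ : ∀ (S T S' T' A A' : D), (β_ (S ⊗ S') (T ⊗ T')).hom ▷ (A ⊗ A') ≫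
      tensorμ T T' S S' ▷ (A ⊗ A') ≫ tensorμ (T ⊗ S) (T' ⊗ S') A A' =
      tensorμ S S' T T' ▷ (A ⊗ A') ≫ tensorμ (S ⊗ T) (S' ⊗ T') A A' ≫
        ((β_ S T).hom ▷ A ⊗ₘ (β_ S' T').hom ▷ A') := by
    intro S T S' T' A A'
    rw [← comp_whiskerRight_assoc, braiding_tensorμ, comp_whiskerRight_assoc,
      tensorμ_natural_left]
  have hα : ∀ (S T S' T' A A' : D), (α_ (T ⊗ T') (S ⊗ S') (A ⊗ A')).inv ≫
      tensorμ T T' S S' ▷ (A ⊗ A') ≫ tensorμ (T ⊗ S) (T' ⊗ S') A A' =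
      (T ⊗ T') ◁ tensorμ S S' A A' ≫ tensorμ T T' (S ⊗ A) (S' ⊗ A') ≫
        ((α_ T S A).inv ⊗ₘ (α_ T' S' A').inv) := by
    intro S T S' T' A A'
    rw [Iso.inv_comp_eq, ← cancel_mono ((α_ T S A).hom ⊗ₘ (α_ T' S' A').hom)]
    have := tensor_associativity T T' S S' A A'
    simp only [Category.assoc, tensorHom_comp_tensorHom, Iso.inv_hom_id]
    rw [this]
    simp
  have hf : ∀ (T T' : D) {S S' A A' B B' : D} (f : S ⊗ A ⟶ S ⊗ B) (f' : S' ⊗ A' ⟶ S' ⊗ B'),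
      (T ⊗ T') ◁ tensorProc f f' ≫ (T ⊗ T') ◁ tensorμ S S' B B' ≫
        tensorμ T T' (S ⊗ B) (S' ⊗ B') =
      (T ⊗ T') ◁ tensorμ S S' A A' ≫ tensorμ T T' (S ⊗ A) (S' ⊗ A') ≫ (T ◁ f ⊗ₘ T' ◁ f') := by
    intro T T' S S' A A' B B' f f'
    rw [← tensorμ_natural_right, ← whiskerLeft_comp_assoc, ← whiskerLeft_comp_assoc]
    simp [tensorProc]
  have hα' : ∀ (S T S' T' A A' : D), (α_ (T ⊗ T') (S ⊗ S') (A ⊗ A')).hom ≫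
      (T ⊗ T') ◁ tensorμ S S' A A' ≫ tensorμ T T' (S ⊗ A) (S' ⊗ A') =
      tensorμ T T' S S' ▷ (A ⊗ A') ≫ tensorμ (T ⊗ S) (T' ⊗ S') A A' ≫
        ((α_ T S A).hom ⊗ₘ (α_ T' S' A').hom) :=
    fun S T S' T' A A' => (tensor_associativity T T' S S' A A').symm
  rw [← cancel_mono (tensorμIso (S ⊗ T) (S' ⊗ T') C C').hom]
  simp only [tensorμIso_hom]
  conv_rhs => simp only [tensorProc, compHom, Category.assoc, tensorδ_tensorμ, Category.comp_id]
  conv_lhs => simp only [compHom, Category.assoc]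
  rw [hα, reassoc_of% hf S S' g g', reassoc_of% hα', reassoc_of% hβ, reassoc_of% hα,
    reassoc_of% hf T T' f f', reassoc_of% hα', reassoc_of% hβ]
  simp only [tensorHom_comp_tensorHom]

theorem tensorProc_assoc {S T U A₁ A₂ A₃ B₁ B₂ B₃ : D} (f : S ⊗ A₁ ⟶ S ⊗ B₁)
    (g : T ⊗ A₂ ⟶ T ⊗ B₂) (h : U ⊗ A₃ ⟶ U ⊗ B₃) :
    (tensorProc (tensorProc f g) h ≫ ((S ⊗ T) ⊗ U) ◁ (α_ B₁ B₂ B₃).hom) ≫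
        (α_ S T U).hom ▷ (B₁ ⊗ B₂ ⊗ B₃) =
      (α_ S T U).hom ▷ ((A₁ ⊗ A₂) ⊗ A₃) ≫
        ((S ⊗ (T ⊗ U)) ◁ (α_ A₁ A₂ A₃).hom ≫ tensorProc f (tensorProc g h)) := by
  have hA := associator_monoidal S T U A₁ A₂ A₃
  have hB := associator_monoidal S T U B₁ B₂ B₃
  rw [← cancel_mono (tensorμIso S (T ⊗ U) B₁ (B₂ ⊗ B₃)).hom,
    ← cancel_mono (whiskerLeftIso (S ⊗ B₁) (tensorμIso T U B₂ B₃)).hom]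
  simp only [Category.assoc, whiskerLeftIso_hom, tensorμIso_hom]
  rw [← MonoidalCategory.tensorHom_def'_assoc, ← MonoidalCategory.tensorHom_def_assoc, ← hB]
  have hl : tensorProc (tensorProc f g) h ≫ tensorμ (S ⊗ T) U (B₁ ⊗ B₂) B₃ ≫
      tensorμ S T B₁ B₂ ▷ (U ⊗ B₃) =
      tensorμ (S ⊗ T) U (A₁ ⊗ A₂) A₃ ≫ tensorμ S T A₁ A₂ ▷ (U ⊗ A₃) ≫ ((f ⊗ₘ g) ⊗ₘ h) := by
    simp only [tensorProc, Category.assoc, tensorδ_tensorμ_assoc,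
      ← MonoidalCategory.tensorHom_id, tensorHom_comp_tensorHom, tensorδ_tensorμ,
      Category.comp_id, Category.id_comp]
  have hr : tensorProc f (tensorProc g h) ≫ tensorμ S (T ⊗ U) B₁ (B₂ ⊗ B₃) ≫
      (S ⊗ B₁) ◁ tensorμ T U B₂ B₃ =
      tensorμ S (T ⊗ U) A₁ (A₂ ⊗ A₃) ≫ (S ⊗ A₁) ◁ tensorμ T U A₂ A₃ ≫ (f ⊗ₘ (g ⊗ₘ h)) := by
    simp only [tensorProc, Category.assoc, tensorδ_tensorμ_assoc,
      ← MonoidalCategory.id_tensorHom, tensorHom_comp_tensorHom, tensorδ_tensorμ,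
      Category.comp_id, Category.id_comp]
  rw [hr, reassoc_of% hl, ← reassoc_of% hA, associator_naturality]

theorem tensorProc_leftUnitor {S : D} (f : S ⊗ A ⟶ S ⊗ B) :
    (tensorProc (𝟙 (𝟙_ D ⊗ 𝟙_ D)) f ≫ (𝟙_ D ⊗ S) ◁ (λ_ B).hom) ≫ (λ_ S).hom ▷ B =
      (λ_ S).hom ▷ (𝟙_ D ⊗ A) ≫ S ◁ (λ_ A).hom ≫ f := by
  rw [Category.assoc, ← MonoidalCategory.tensorHom_def', ← MonoidalCategory.tensorHom_def_assoc,
    leftUnitor_monoidal, leftUnitor_monoidal]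
  simp [tensorProc]

theorem tensorProc_rightUnitor {S : D} (f : S ⊗ A ⟶ S ⊗ B) :
    (tensorProc f (𝟙 (𝟙_ D ⊗ 𝟙_ D)) ≫ (S ⊗ 𝟙_ D) ◁ (ρ_ B).hom) ≫ (ρ_ S).hom ▷ B =
      (ρ_ S).hom ▷ (A ⊗ 𝟙_ D) ≫ S ◁ (ρ_ A).hom ≫ f := by
  rw [Category.assoc, ← MonoidalCategory.tensorHom_def', ← MonoidalCategory.tensorHom_def_assoc,
    rightUnitor_monoidal, rightUnitor_monoidal]
  simp only [tensorProc, Category.assoc, tensorδ_tensorμ_assoc, MonoidalCategory.tensorHom_id]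
  rw [← whisker_exchange_assoc, rightUnitor_naturality]

theorem tensorProc_braiding {S T : D} (f : S ⊗ A ⟶ S ⊗ B) (g : T ⊗ A' ⟶ T ⊗ B') :
    (tensorProc f g ≫ (S ⊗ T) ◁ (β_ B B').hom) ≫ (β_ S T).hom ▷ (B' ⊗ B) =
      (β_ S T).hom ▷ (A ⊗ A') ≫ (T ⊗ S) ◁ (β_ A A').hom ≫ tensorProc g f := by
  rw [Category.assoc, ← MonoidalCategory.tensorHom_def', ← MonoidalCategory.tensorHom_def_assoc,
    ← cancel_mono (tensorμIso T S B' B).hom]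
  simp only [Category.assoc, tensorμIso_hom]
  rw [← tensorμ_braiding]
  simp only [tensorProc, Category.assoc, tensorδ_tensorμ_assoc, tensorδ_tensorμ, Category.comp_id,
    BraidedCategory.braiding_naturality]
  rw [← reassoc_of% tensorμ_braiding]

theorem tensorProc_pure {A₁ A₂ B₁ B₂ : D} (u : A₁ ⟶ B₁) (v : A₂ ⟶ B₂) :
    tensorProc (𝟙_ D ◁ u) (𝟙_ D ◁ v) ≫ (λ_ (𝟙_ D)).hom ▷ (B₁ ⊗ B₂) =
      (λ_ (𝟙_ D)).hom ▷ (A₁ ⊗ A₂) ≫ 𝟙_ D ◁ (u ⊗ₘ v) := by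
  rw [tensorProc, ← tensorμ_natural_right_assoc, tensorμ_tensorδ, Category.comp_id,
    whisker_exchange]

end
end StProc

/-- Objects of `St(D)`: a copy of the objects of `D`. Morphisms are stateful processes up to
isomorphism of the state space. -/
structure St (D : Type u) where
  obj : D

namespace St

variable {D : Type u} [Category.{v} D] [MonoidalCategory D] [SymmetricCategory D]

instance : CategoryStruct (St D) where
  Hom X Y := Quotient (StProc.setoid X.obj Y.obj)
  id X := Quotient.mk _ ⟨𝟙_ D, 𝟙 (𝟙_ D ⊗ X.obj)⟩
  comp := Quotient.map₂ (fun P Q => ⟨P.state ⊗ Q.state, StProc.compHom P.hom Q.hom⟩) (by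
    rintro ⟨S, f⟩ ⟨S', f'⟩ h ⟨T, g⟩ ⟨T', g'⟩ k
    obtain ⟨h, e⟩ := StProc.exists_iso h
    obtain ⟨k, e'⟩ := StProc.exists_iso k
    exact StProc.equiv_mk _ (StProc.compHom_congr h k e e'))

/-- The morphism `(S ∣ f)` of `St(D)`. -/
def homMk {X Y : St D} (S : D) (f : S ⊗ X.obj ⟶ S ⊗ Y.obj) : X ⟶ Y :=
  Quotient.mk _ ⟨S, f⟩

variable {X Y Z W : St D}

theorem hom_ind {motive : (X ⟶ Y) → Prop}
    (h : ∀ (S : D) (f : S ⊗ X.obj ⟶ S ⊗ Y.obj), motive (homMk S f)) (q : X ⟶ Y) : motive q :=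
  Quotient.ind (fun P => h P.state P.hom) q

theorem homMk_eq {S T : D} {f : S ⊗ X.obj ⟶ S ⊗ Y.obj} {g : T ⊗ X.obj ⟶ T ⊗ Y.obj} (h : S ≅ T)
    (e : f ≫ h.hom ▷ Y.obj = h.hom ▷ X.obj ≫ g) : (homMk S f : X ⟶ Y) = homMk T g :=
  Quotient.sound (StProc.equiv_mk h e)

theorem homMk_comp {S T : D} (f : S ⊗ X.obj ⟶ S ⊗ Y.obj) (g : T ⊗ Y.obj ⟶ T ⊗ Z.obj) :
    homMk S f ≫ homMk T g = (homMk (S ⊗ T) (StProc.compHom f g) : X ⟶ Z) := rfl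

theorem id_def (X : St D) : 𝟙 X = homMk (𝟙_ D) (𝟙 (𝟙_ D ⊗ X.obj)) := rfl

/-- A morphism of the base, as a stateful process. -/
def pureHom (u : X.obj ⟶ Y.obj) : X ⟶ Y := homMk (𝟙_ D) (𝟙_ D ◁ u)

theorem pureHom_homMk (u : X.obj ⟶ Y.obj) {S : D} (f : S ⊗ Y.obj ⟶ S ⊗ Z.obj) :
    (pureHom u : X ⟶ Y) ≫ homMk S f = homMk S (S ◁ u ≫ f) :=
  homMk_eq (λ_ S) (StProc.pure_compHom u f)

theorem homMk_pureHom {S : D} (f : S ⊗ X.obj ⟶ S ⊗ Y.obj) (u : Y.obj ⟶ Z.obj) :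
    homMk S f ≫ (pureHom u : Y ⟶ Z) = homMk S (f ≫ S ◁ u) :=
  homMk_eq (ρ_ S) (StProc.compHom_pure f u)

theorem pureHom_id (X : St D) : pureHom (𝟙 X.obj) = 𝟙 X := by
  simp [pureHom, id_def]

theorem pureHom_comp (u : X.obj ⟶ Y.obj) (v : Y.obj ⟶ Z.obj) :
    (pureHom (u ≫ v) : X ⟶ Z) = (pureHom u : X ⟶ Y) ≫ pureHom v := by
  rw [pureHom, pureHom, homMk_pureHom, whiskerLeft_comp]

instance : Category (St D) where
  id_comp {X Y} f := by
    induction f using hom_ind with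
    | h S f => rw [← pureHom_id, pureHom_homMk, whiskerLeft_id, Category.id_comp]
  comp_id {X Y} f := by
    induction f using hom_ind with
    | h S f => rw [← pureHom_id, homMk_pureHom, whiskerLeft_id, Category.comp_id]
  assoc {X Y Z W} f g h := by
    induction f using hom_ind with
    | h S f => induction g using hom_ind with
      | h T g => induction h using hom_ind with
        | h U h => exact homMk_eq (α_ S T U) (StProc.compHom_assoc f g h)

/-- An isomorphism of the base, as an isomorphism of stateful processes. -/
@[simps]
def pureIso (u : X.obj ≅ Y.obj) : X ≅ Y where
  hom := pureHom u.hom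
  inv := pureHom u.inv
  hom_inv_id := by rw [← pureHom_comp, Iso.hom_inv_id, pureHom_id]
  inv_hom_id := by rw [← pureHom_comp, Iso.inv_hom_id, pureHom_id]

/-- Parallel composition of stateful processes. -/
def tensorMap {X Y X' Y' : St D} : (X ⟶ Y) → (X' ⟶ Y') →
    ((⟨X.obj ⊗ X'.obj⟩ : St D) ⟶ ⟨Y.obj ⊗ Y'.obj⟩) :=
  Quotient.map₂ (fun P Q => ⟨P.state ⊗ Q.state, StProc.tensorProc P.hom Q.hom⟩) (by
    rintro ⟨S, f⟩ ⟨S', f'⟩ h ⟨T, g⟩ ⟨T', g'⟩ k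
    obtain ⟨h, e⟩ := StProc.exists_iso h
    obtain ⟨k, e'⟩ := StProc.exists_iso k
    exact StProc.equiv_mk _ (StProc.tensorProc_congr h k e e'))

instance : MonoidalCategoryStruct (St D) where
  tensorObj X Y := ⟨X.obj ⊗ Y.obj⟩
  tensorHom := tensorMap
  whiskerLeft X _ _ f := tensorMap (𝟙 X) f
  whiskerRight f Y := tensorMap f (𝟙 Y)
  tensorUnit := ⟨𝟙_ D⟩
  associator X Y Z := pureIso (X := ⟨(X.obj ⊗ Y.obj) ⊗ Z.obj⟩) (α_ X.obj Y.obj Z.obj)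
  leftUnitor X := pureIso (X := ⟨𝟙_ D ⊗ X.obj⟩) (λ_ X.obj)
  rightUnitor X := pureIso (X := ⟨X.obj ⊗ 𝟙_ D⟩) (ρ_ X.obj)

theorem homMk_tensorHom {X Y X' Y' : St D} {S T : D} (f : S ⊗ X.obj ⟶ S ⊗ Y.obj)
    (g : T ⊗ X'.obj ⟶ T ⊗ Y'.obj) :
    (homMk S f : X ⟶ Y) ⊗ₘ (homMk T g : X' ⟶ Y') =
      homMk (X := X ⊗ X') (Y := Y ⊗ Y') (S ⊗ T) (StProc.tensorProc f g) := rfl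

theorem pureHom_tensorHom {X Y X' Y' : St D} (u : X.obj ⟶ Y.obj) (v : X'.obj ⟶ Y'.obj) :
    (pureHom u : X ⟶ Y) ⊗ₘ (pureHom v : X' ⟶ Y') =
      pureHom (X := X ⊗ X') (Y := Y ⊗ Y') (u ⊗ₘ v) :=
  homMk_eq (X := X ⊗ X') (Y := Y ⊗ Y') (λ_ (𝟙_ D)) (StProc.tensorProc_pure u v)

instance : MonoidalCategory (St D) := MonoidalCategory.ofTensorHom
  (id_tensorHom_id := fun X Y => by
    rw [← pureHom_id, ← pureHom_id, pureHom_tensorHom, id_tensorHom_id]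
    exact pureHom_id (X ⊗ Y))
  (id_tensorHom := fun _ _ _ _ => rfl)
  (tensorHom_id := fun _ _ => rfl)
  (tensorHom_comp_tensorHom := fun {X₁ Y₁ Z₁ X₂ Y₂ Z₂} f f' g g' => by
    induction f using hom_ind with
    | h S f => induction g using hom_ind with
      | h T g => induction f' using hom_ind with
        | h S' f' => induction g' using hom_ind with
          | h T' g' =>
            exact homMk_eq (X := X₁ ⊗ X₂) (Y := Z₁ ⊗ Z₂) (StProc.tensorμIso S S' T T')
              (StProc.tensorProc_compHom f g f' g'))
  (associator_naturality := fun {X₁ X₂ X₃ Y₁ Y₂ Y₃} f g h => by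
    induction f using hom_ind with
    | h S f => induction g using hom_ind with
      | h T g => induction h using hom_ind with
        | h U h =>
          refine (homMk_pureHom (X := (X₁ ⊗ X₂) ⊗ X₃) (Y := (Y₁ ⊗ Y₂) ⊗ Y₃) (Z := Y₁ ⊗ Y₂ ⊗ Y₃)
            _ _).trans (Eq.trans ?_ (pureHom_homMk (X := (X₁ ⊗ X₂) ⊗ X₃) (Y := X₁ ⊗ X₂ ⊗ X₃)
              (Z := Y₁ ⊗ Y₂ ⊗ Y₃) _ _).symm)
          exact homMk_eq (X := (X₁ ⊗ X₂) ⊗ X₃) (Y := Y₁ ⊗ Y₂ ⊗ Y₃)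
            (α_ S T U) (StProc.tensorProc_assoc f g h))
  (leftUnitor_naturality := fun {X Y} f => by
    induction f using hom_ind with
    | h S f =>
      refine (homMk_pureHom (X := 𝟙_ (St D) ⊗ X) (Y := 𝟙_ (St D) ⊗ Y) (Z := Y)
        _ _).trans (Eq.trans ?_ (pureHom_homMk (X := 𝟙_ (St D) ⊗ X) (Y := X) (Z := Y) _ _).symm)
      exact homMk_eq (X := 𝟙_ (St D) ⊗ X) (Y := Y) (λ_ S) (StProc.tensorProc_leftUnitor f))
  (rightUnitor_naturality := fun {X Y} f => by
    induction f using hom_ind with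
    | h S f =>
      refine (homMk_pureHom (X := X ⊗ 𝟙_ (St D)) (Y := Y ⊗ 𝟙_ (St D)) (Z := Y)
        _ _).trans (Eq.trans ?_ (pureHom_homMk (X := X ⊗ 𝟙_ (St D)) (Y := X) (Z := Y) _ _).symm)
      exact homMk_eq (X := X ⊗ 𝟙_ (St D)) (Y := Y) (ρ_ S) (StProc.tensorProc_rightUnitor f))
  (pentagon := fun W X Y Z => by
    have h := congrArg (pureHom (X := ((W ⊗ X) ⊗ Y) ⊗ Z) (Y := W ⊗ X ⊗ Y ⊗ Z))
      (MonoidalCategory.pentagon W.obj X.obj Y.obj Z.obj)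
    rw [← MonoidalCategory.tensorHom_id, ← MonoidalCategory.id_tensorHom] at h
    rw [pureHom_comp (Y := (W ⊗ X ⊗ Y) ⊗ Z), pureHom_comp (Y := W ⊗ (X ⊗ Y) ⊗ Z),
      pureHom_comp (Y := (W ⊗ X) ⊗ Y ⊗ Z)] at h
    have e₁ := pureHom_tensorHom (X := (W ⊗ X) ⊗ Y) (Y := W ⊗ X ⊗ Y) (X' := Z) (Y' := Z)
      (α_ W.obj X.obj Y.obj).hom (𝟙 Z.obj)
    have e₂ := pureHom_tensorHom (X := W) (Y := W) (X' := (X ⊗ Y) ⊗ Z) (Y' := X ⊗ Y ⊗ Z)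
      (𝟙 W.obj) (α_ X.obj Y.obj Z.obj).hom
    rw [pureHom_id] at e₁ e₂
    exact (congrArg₂ (fun a b => a ≫ (α_ W (X ⊗ Y) Z).hom ≫ b) e₁ e₂).trans h)
  (triangle := fun X Y => by
    have h := congrArg (pureHom (X := (X ⊗ 𝟙_ _) ⊗ Y) (Y := X ⊗ Y))
      (MonoidalCategory.triangle X.obj Y.obj)
    rw [← MonoidalCategory.tensorHom_id, ← MonoidalCategory.id_tensorHom,
      pureHom_comp (Y := X ⊗ 𝟙_ _ ⊗ Y)] at h
    have e₁ := pureHom_tensorHom (X := X ⊗ 𝟙_ _) (Y := X) (X' := Y) (Y' := Y)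
      (ρ_ X.obj).hom (𝟙 Y.obj)
    have e₂ := pureHom_tensorHom (X := X) (Y := X) (X' := 𝟙_ _ ⊗ Y) (Y' := Y)
      (𝟙 X.obj) (λ_ Y.obj).hom
    rw [pureHom_id] at e₁ e₂
    exact ((congrArg (fun b => (α_ X (𝟙_ (St D)) Y).hom ≫ b) e₂).trans h).trans e₁.symm)

theorem associator_hom (X Y Z : St D) :
    (α_ X Y Z).hom = pureHom (X := (X ⊗ Y) ⊗ Z) (Y := X ⊗ Y ⊗ Z) (α_ X.obj Y.obj Z.obj).hom := rfl

theorem whiskerLeft_pureHom (X : St D) (u : Y.obj ⟶ Z.obj) :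
    X ◁ (pureHom u : Y ⟶ Z) = pureHom (X := X ⊗ Y) (Y := X ⊗ Z) (X.obj ◁ u) := by
  rw [← MonoidalCategory.id_tensorHom, ← pureHom_id, pureHom_tensorHom,
    MonoidalCategory.id_tensorHom]

theorem pureHom_whiskerRight (u : Y.obj ⟶ Z.obj) (X : St D) :
    (pureHom u : Y ⟶ Z) ▷ X = pureHom (X := Y ⊗ X) (Y := Z ⊗ X) (u ▷ X.obj) := by
  rw [← MonoidalCategory.tensorHom_id, ← pureHom_id, pureHom_tensorHom,
    MonoidalCategory.tensorHom_id]

theorem tensorHom_braiding {X Y X' Y' : St D} (f : X ⟶ Y) (g : X' ⟶ Y') :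
    (f ⊗ₘ g) ≫ pureHom (X := Y ⊗ Y') (Y := Y' ⊗ Y) (β_ Y.obj Y'.obj).hom =
      pureHom (X := X ⊗ X') (Y := X' ⊗ X) (β_ X.obj X'.obj).hom ≫ (g ⊗ₘ f) := by
  induction f using hom_ind with
  | h S f => induction g using hom_ind with
    | h T g =>
      refine (homMk_pureHom (X := X ⊗ X') (Y := Y ⊗ Y') (Z := Y' ⊗ Y) _ _).trans
        (Eq.trans ?_ (pureHom_homMk (X := X ⊗ X') (Y := X' ⊗ X) (Z := Y' ⊗ Y) _ _).symm)
      exact homMk_eq (X := X ⊗ X') (Y := Y' ⊗ Y) (β_ S T) (StProc.tensorProc_braiding f g)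

instance : SymmetricCategory (St D) where
  braiding X Y := pureIso (X := X ⊗ Y) (Y := Y ⊗ X) (β_ X.obj Y.obj)
  braiding_naturality_right X Y Z f := by
    rw [← MonoidalCategory.id_tensorHom, ← MonoidalCategory.tensorHom_id]
    exact tensorHom_braiding _ _
  braiding_naturality_left f Z := by
    rw [← MonoidalCategory.id_tensorHom, ← MonoidalCategory.tensorHom_id]
    exact tensorHom_braiding _ _
  hexagon_forward X Y Z := by
    have h := congrArg (pureHom (X := (X ⊗ Y) ⊗ Z) (Y := Y ⊗ Z ⊗ X))
      (BraidedCategory.hexagon_forward X.obj Y.obj Z.obj)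
    rw [pureHom_comp (Y := X ⊗ Y ⊗ Z), pureHom_comp (Y := (Y ⊗ Z) ⊗ X),
      pureHom_comp (Y := (Y ⊗ X) ⊗ Z), pureHom_comp (Y := Y ⊗ X ⊗ Z)] at h
    have e₁ := pureHom_whiskerRight (Y := X ⊗ Y) (Z := Y ⊗ X) (β_ X.obj Y.obj).hom Z
    have e₂ := whiskerLeft_pureHom Y (Y := X ⊗ Z) (Z := Z ⊗ X) (β_ X.obj Z.obj).hom
    exact h.trans (congrArg₂ (fun a b => a ≫ (α_ Y X Z).hom ≫ b) e₁ e₂).symm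
  hexagon_reverse X Y Z := by
    have h := congrArg (pureHom (X := X ⊗ Y ⊗ Z) (Y := (Z ⊗ X) ⊗ Y))
      (BraidedCategory.hexagon_reverse X.obj Y.obj Z.obj)
    rw [pureHom_comp (Y := (X ⊗ Y) ⊗ Z), pureHom_comp (Y := Z ⊗ X ⊗ Y),
      pureHom_comp (Y := X ⊗ Z ⊗ Y), pureHom_comp (Y := (X ⊗ Z) ⊗ Y)] at h
    have e₁ := whiskerLeft_pureHom X (Y := Y ⊗ Z) (Z := Z ⊗ Y) (β_ Y.obj Z.obj).hom
    have e₂ := pureHom_whiskerRight (Y := X ⊗ Z) (Z := Z ⊗ X) (β_ X.obj Z.obj).hom Y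
    exact h.trans (congrArg₂ (fun a b => a ≫ (α_ X Z Y).inv ≫ b) e₁ e₂).symm
  symmetry X Y := by
    have h := congrArg (pureHom (X := X ⊗ Y) (Y := X ⊗ Y))
      (SymmetricCategory.symmetry X.obj Y.obj)
    rw [pureHom_comp (Y := Y ⊗ X)] at h
    exact h.trans (pureHom_id (X ⊗ Y))

/-- The identity-on-objects inclusion `D ⥤ St(D)`, sending `u` to `(I ∣ 1 ⊗ u)`. -/
def incl (D : Type u) [Category.{v} D] [MonoidalCategory D] [SymmetricCategory D] : D ⥤ St D where
  obj A := ⟨A⟩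
  map u := pureHom u
  map_id A := pureHom_id ⟨A⟩
  map_comp {A B C} u v := pureHom_comp (X := ⟨A⟩) (Y := ⟨B⟩) (Z := ⟨C⟩) u v

/-- The inclusion is strictly symmetric monoidal: its structure isomorphisms are identities. -/
instance inclBraided : (incl D).Braided where
  toMonoidal := Functor.CoreMonoidal.toMonoidal
    { εIso := Iso.refl _
      μIso := fun _ _ => Iso.refl _
      μIso_hom_natural_left := fun {X Y} f Z =>
        (Category.comp_id _).trans ((pureHom_whiskerRight (Y := ⟨X⟩) (Z := ⟨Y⟩) f ⟨Z⟩).trans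
          (Category.id_comp _).symm)
      μIso_hom_natural_right := fun {X Y} Z f =>
        (Category.comp_id _).trans ((whiskerLeft_pureHom ⟨Z⟩ (Y := ⟨X⟩) (Z := ⟨Y⟩) f).trans
          (Category.id_comp _).symm)
      associativity := fun X Y Z => by
        change 𝟙 ((⟨X⟩ : St D) ⊗ ⟨Y⟩) ▷ (⟨Z⟩ : St D) ≫ 𝟙 (((⟨X⟩ : St D) ⊗ ⟨Y⟩) ⊗ ⟨Z⟩) ≫
          (α_ (⟨X⟩ : St D) ⟨Y⟩ ⟨Z⟩).hom = (α_ (⟨X⟩ : St D) ⟨Y⟩ ⟨Z⟩).hom ≫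
          (⟨X⟩ : St D) ◁ 𝟙 ((⟨Y⟩ : St D) ⊗ ⟨Z⟩) ≫ 𝟙 ((⟨X⟩ : St D) ⊗ ⟨Y⟩ ⊗ ⟨Z⟩)
        simp
      left_unitality := fun X => by
        change (λ_ (⟨X⟩ : St D)).hom = 𝟙 (𝟙_ (St D)) ▷ (⟨X⟩ : St D) ≫
          𝟙 (𝟙_ (St D) ⊗ (⟨X⟩ : St D)) ≫ (λ_ (⟨X⟩ : St D)).hom
        simp
      right_unitality := fun X => by
        change (ρ_ (⟨X⟩ : St D)).hom = (⟨X⟩ : St D) ◁ 𝟙 (𝟙_ (St D)) ≫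
          𝟙 ((⟨X⟩ : St D) ⊗ 𝟙_ (St D)) ≫ (ρ_ (⟨X⟩ : St D)).hom
        simp }
  braided X Y := (Category.id_comp _).trans (Category.comp_id _).symm

/-- The feedback operator of `St(D)`: it stores `T` into the state,
`store T (S ∣ f) = (S ⊗ T ∣ f)` up to associators. -/
def store (T : St D) {A B : St D} : (T ⊗ A ⟶ T ⊗ B) → (A ⟶ B) :=
  Quotient.map (fun P => ⟨P.state ⊗ T.obj, (α_ P.state T.obj A.obj).hom ≫ P.hom ≫
    (α_ P.state T.obj B.obj).inv⟩) (by
    rintro ⟨S, f⟩ ⟨S', f'⟩ h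
    obtain ⟨h, e⟩ := StProc.exists_iso h
    refine StProc.equiv_mk (whiskerRightIso h T.obj) ?_
    change f ≫ h.hom ▷ (T.obj ⊗ B.obj) = h.hom ▷ (T.obj ⊗ A.obj) ≫ f' at e
    simp only [whiskerRightIso_hom, Category.assoc, ← associator_inv_naturality_left,
      associator_naturality_left_assoc]
    rw [← reassoc_of% e])

end St

/-! ### Feedback categories -/

/-- A feedback operator on a symmetric monoidal category `D`. -/
structure FeedbackStructure (D : Type u) [Category.{v} D] [MonoidalCategory D]
    [SymmetricCategory D] where
  /-- the operator, feeding back the object `S` -/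
  fbk : ∀ (S : D) {A B : D}, (S ⊗ A ⟶ S ⊗ B) → (A ⟶ B)
  tightening : ∀ (S : D) {A A' B B' : D} (u : A' ⟶ A) (f : S ⊗ A ⟶ S ⊗ B) (v : B ⟶ B'),
    u ≫ fbk S f ≫ v = fbk S (S ◁ u ≫ f ≫ S ◁ v)
  vanishing : ∀ {A B : D} (f : A ⟶ B), fbk (𝟙_ D) ((λ_ A).hom ≫ f ≫ (λ_ B).inv) = f
  joining : ∀ (S T : D) {A B : D} (f : S ⊗ T ⊗ A ⟶ S ⊗ T ⊗ B),
    fbk T (fbk S f) = fbk (S ⊗ T) ((α_ S T A).hom ≫ f ≫ (α_ S T B).inv)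
  strength : ∀ (S : D) {A B A' B' : D} (f : S ⊗ A ⟶ S ⊗ B) (g : A' ⟶ B'),
    fbk S f ⊗ₘ g = fbk S ((α_ S A A').inv ≫ (f ⊗ₘ g) ≫ (α_ S B B').hom)
  sliding : ∀ {S T A B : D} (f : T ⊗ A ⟶ S ⊗ B) (h : S ≅ T),
    fbk T (f ≫ h.hom ▷ B) = fbk S (h.hom ▷ A ≫ f)

/-- Symmetric strong monoidal functors, bundled with their structure isomorphisms. -/
structure SymMonFunctor (D : Type u₁) [Category.{v₁} D] [MonoidalCategory D] [SymmetricCategory D]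
    (E : Type u₂) [Category.{v₂} E] [MonoidalCategory E] [SymmetricCategory E] where
  /-- the underlying functor -/
  toFunctor : D ⥤ E
  /-- the coherent structure isomorphisms, compatible with the symmetries -/
  braided : toFunctor.Braided

namespace SymMonFunctor

attribute [instance] SymMonFunctor.braided

variable {D : Type u₁} [Category.{v₁} D] [MonoidalCategory D] [SymmetricCategory D]
  {E : Type u₂} [Category.{v₂} E] [MonoidalCategory E] [SymmetricCategory E]
  {X : Type u₃} [Category.{v₃} X] [MonoidalCategory X] [SymmetricCategory X]

/-- Composition of symmetric strong monoidal functors. -/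
def comp (F : SymMonFunctor D E) (G : SymMonFunctor E X) : SymMonFunctor D X :=
  ⟨F.toFunctor ⋙ G.toFunctor, inferInstance⟩

/-- `F` is a feedback functor: it transports feedback along its structure isomorphisms. -/
def PreservesFeedback (F : SymMonFunctor D E) (φ : FeedbackStructure D)
    (ψ : FeedbackStructure E) : Prop :=
  ∀ (S : D) {A B : D} (f : S ⊗ A ⟶ S ⊗ B),
    F.toFunctor.map (φ.fbk S f) =
      ψ.fbk (F.toFunctor.obj S) (Functor.LaxMonoidal.μ F.toFunctor S A ≫
        F.toFunctor.map f ≫ Functor.OplaxMonoidal.δ F.toFunctor S B)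

end SymMonFunctor

/-- `(E, φ)` is the free feedback category over `D` along `ι : D ⥤ E`: every symmetric strong
monoidal functor from `D` to a feedback category extends along `ι` to a unique feedback functor
from `E`. -/
def IsFreeFeedbackCategory {D : Type u₁} [Category.{v₁} D] [MonoidalCategory D]
    [SymmetricCategory D] {E : Type u₂} [Category.{v₂} E] [MonoidalCategory E]
    [SymmetricCategory E] (φ : FeedbackStructure E) (ι : SymMonFunctor D E) : Prop :=
  ∀ (X : Type u₃) [Category.{v₃} X] [MonoidalCategory X] [SymmetricCategory X]
    (ψ : FeedbackStructure X) (F : SymMonFunctor D X),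
    ∃! G : SymMonFunctor E X, G.PreservesFeedback φ ψ ∧ ι.comp G = F

/-- The inclusion `D ⥤ St(D)` as a symmetric strong monoidal functor. -/
def St.inclusion (D : Type u₁) [Category.{v₁} D] [MonoidalCategory D] [SymmetricCategory D] :
    SymMonFunctor D (St D) :=
  ⟨St.incl D, inferInstance⟩

/-! ### Internal graphs with a single vertex -/

/-- Internal graphs in `C`: functors from the category `• ⇉ •`. The value at `zero` is the object
of edges, the value at `one` is the object of vertices. -/
abbrev InternalGraph (C : Type u) [Category.{v} C] : Type (max v u) := WalkingParallelPair ⥤ C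

/-- The graph `A ⇉ 1`. -/
def bouquet {C : Type u} [Category.{v} C] [CartesianMonoidalCategory C] (A : C) :
    InternalGraph C :=
  parallelPair (toUnit A) (toUnit A)

/-- The graphs of the form `A ⇉ 1`, among the objects of `Span(Graph(C))`. -/
def isBouquet (C : Type u) [Category.{v} C] [HasPullbacks C] [CartesianMonoidalCategory C] :
    ObjectProperty (SpanCat (InternalGraph C)) :=
  fun G => ∃ A : C, G.obj = bouquet A

/-- The full subcategory of `Span(Graph(C))` on the graphs of the form `A ⇉ 1`. -/
abbrev SpanGraphStar (C : Type u) [Category.{v} C] [HasPullbacks C]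
    [CartesianMonoidalCategory C] : Type (max v u) :=
  (isBouquet C).FullSubcategory

/-!
The proof has two independent halves.

**The free feedback category.** For an arbitrary symmetric monoidal category `D`, `St(D)` with
`store` is the free feedback category over `D`. Every process is `store` of a morphism of `D`
(`St.homMk_eq_store`), so a feedback functor `G` on `St(D)` is determined by its restriction to `D`;
conversely a functor `F` extends by `(S ∣ f) ↦ fbk (F f)`, which is well defined by sliding and
functorial because two consecutive feedback loops merge into one
(`FeedbackStructure.fbk_comp_fbk`). Coherence computations are organised by `StProc.place`, the
action of a process on a tensor factor of its state space: every composite of processes is a product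
of such actions, a strong monoidal functor preserves them (`SymMonFunctor.transport_place`), and so
does the regrouping `StProc.regroup` that underlies `store` (`StProc.regroup_place`). Equations
between processes then become equations between permutations of the state space.

The delicate axiom for `store` is sliding, since an isomorphism `(U ∣ h) : S ≅ T` of `St(D)` need
not come from `D`. Its state space `U` is however invertible, hence `h : U ⊗ S ⟶ U ⊗ T` is an
isomorphism of `D` (`St.isIso_of_iso`), and it is `h` that identifies the two sides of the sliding
equation.

**Spans of graphs.** A process `(S ∣ S ⊗ A ⟵ E ⟶ S ⊗ B)` over `Span(C)` consists of two maps `E ⇉ S`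
and two labels `E ⟶ A`, `E ⟶ B`: it is a graph with edges `E` and vertices `S`, lying over `A ⇉ 1`
and `B ⇉ 1`. Both notions of isomorphism agree, because an invertible span is the graph of an
isomorphism of `C` (`SpanCat.exists_graphHom_eq_hom`). A composite of processes has state space
`S ⊗ T` and the composable pairs of edges as its span (`SpanCat.compHom_homMk`), and this is the
pullback of the graphs (`isPullback_bouquet`). A morphism to `A ⇉ 1` is determined by its value on
edges (`bouquet_hom_ext`), so the coherence conditions for the comparison of tensor products hold
because they hold in `C`.
-/

/-! ### Symmetric strong monoidal functors -/

section
variable {D : Type u₁} [Category.{v₁} D] [MonoidalCategory D] [SymmetricCategory D]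
  {E : Type u₂} [Category.{v₂} E] [MonoidalCategory E] [SymmetricCategory E]

/-- A symmetric strong monoidal structure on a functor between symmetric monoidal categories.
Naturality in the second variable and right unitality follow from their left-hand counterparts by
means of the symmetries. -/
@[reducible]
def CategoryTheory.Functor.Braided.ofNaturalLeft (F : D ⥤ E) (εIso : 𝟙_ E ≅ F.obj (𝟙_ D))
    (μIso : ∀ X Y : D, F.obj X ⊗ F.obj Y ≅ F.obj (X ⊗ Y))
    (natural_left : ∀ {X Y : D} (f : X ⟶ Y) (Z : D),
      F.map f ▷ F.obj Z ≫ (μIso Y Z).hom = (μIso X Z).hom ≫ F.map (f ▷ Z))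
    (associativity : ∀ X Y Z : D,
      (μIso X Y).hom ▷ F.obj Z ≫ (μIso (X ⊗ Y) Z).hom ≫ F.map (α_ X Y Z).hom =
        (α_ (F.obj X) (F.obj Y) (F.obj Z)).hom ≫ F.obj X ◁ (μIso Y Z).hom ≫ (μIso X (Y ⊗ Z)).hom)
    (left_unitality : ∀ X : D,
      (λ_ (F.obj X)).hom = εIso.hom ▷ F.obj X ≫ (μIso (𝟙_ D) X).hom ≫ F.map (λ_ X).hom)
    (braided : ∀ X Y : D, (μIso X Y).hom ≫ F.map (β_ X Y).hom =
      (β_ (F.obj X) (F.obj Y)).hom ≫ (μIso Y X).hom) : F.Braided where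
  toMonoidal := Functor.CoreMonoidal.toMonoidal
    { εIso := εIso
      μIso := μIso
      μIso_hom_natural_left := natural_left
      μIso_hom_natural_right := fun {X Y} Z f => by
        have h := (β_ (F.obj Z) (F.obj X)).hom ≫= natural_left f Z
        rw [← reassoc_of% braided, ← F.map_comp, ← BraidedCategory.braiding_naturality_right,
          F.map_comp, ← BraidedCategory.braiding_naturality_right_assoc, ← braided,
          ← Category.assoc, ← Category.assoc, cancel_mono] at h
        exact h
      associativity := associativity
      left_unitality := left_unitality
      right_unitality := fun X => by
        rw [← braiding_leftUnitor, left_unitality,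
          ← BraidedCategory.braiding_naturality_right_assoc, ← reassoc_of% braided, ← F.map_comp,
          braiding_leftUnitor] }
  braided := braided

/-- In a symmetric monoidal category, left whiskering is right whiskering up to symmetries. -/
theorem CategoryTheory.SymmetricCategory.whiskerLeft_eq {A B : D} (X : D) (f : A ⟶ B) :
    X ◁ f = (β_ X A).hom ≫ f ▷ X ≫ (β_ B X).hom := by
  rw [← BraidedCategory.braiding_naturality_right_assoc, SymmetricCategory.symmetry,
    Category.comp_id]

/-- Two symmetric strong monoidal functors agree as soon as their underlying functors and their lax
structure maps do: the oplax structure maps are inverses of these. -/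
theorem SymMonFunctor.ext {F G : SymMonFunctor D E} (h : F.toFunctor = G.toFunctor)
    (hε : HEq F.braided.ε G.braided.ε)
    (hμ : ∀ X Y, HEq (F.braided.μ X Y) (G.braided.μ X Y)) : F = G := by
  obtain ⟨F, b⟩ := F
  obtain ⟨G, b'⟩ := G
  obtain rfl : F = G := h
  congr
  have hε' : b.ε = b'.ε := eq_of_heq hε
  have hμ' : b.μ = b'.μ := by
    ext X Y
    exact eq_of_heq (hμ X Y)
  have hη : b.η = b'.η := calc
    b.η = b.η ≫ b'.ε ≫ b'.η := by rw [b'.ε_η, Category.comp_id]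
    _ = b'.η := by rw [← hε', ← Category.assoc, b.η_ε, Category.id_comp]
  have hδ : b.δ = b'.δ := by
    ext X Y
    calc
      b.δ X Y = b.δ X Y ≫ b'.μ X Y ≫ b'.δ X Y := by rw [b'.μ_δ, Category.comp_id]
      _ = b'.δ X Y := by rw [← hμ', ← Category.assoc, b.δ_μ, Category.id_comp]
  exact Functor.Braided.ext hε' hμ' hη hδ

end

/-! ### Consequences of the feedback axioms -/

namespace FeedbackStructure
variable {D : Type u} [Category.{v} D] [MonoidalCategory D] [SymmetricCategory D]
  (φ : FeedbackStructure D) {S T A A' B B' C : D}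

theorem comp_fbk (u : A' ⟶ A) (f : S ⊗ A ⟶ S ⊗ B) : u ≫ φ.fbk S f = φ.fbk S (S ◁ u ≫ f) := by
  simpa using φ.tightening S u f (𝟙 B)

theorem fbk_comp (f : S ⊗ A ⟶ S ⊗ B) (v : B ⟶ B') : φ.fbk S f ≫ v = φ.fbk S (f ≫ S ◁ v) := by
  simpa using φ.tightening S (𝟙 A) f v

theorem fbk_whiskerRight (f : S ⊗ A ⟶ S ⊗ B) (C : D) :
    φ.fbk S f ▷ C = φ.fbk S ((α_ S A C).inv ≫ f ▷ C ≫ (α_ S B C).hom) := by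
  rw [← tensorHom_id, φ.strength, tensorHom_id]

/-- Feedback is invariant under isomorphisms of the object fed back. -/
theorem fbk_conj (h : S ≅ T) {f : S ⊗ A ⟶ S ⊗ B} {g : T ⊗ A ⟶ T ⊗ B}
    (e : f ≫ h.hom ▷ B = h.hom ▷ A ≫ g) : φ.fbk S f = φ.fbk T g := by
  have hs := φ.sliding (g ≫ h.inv ▷ B) h
  rw [← reassoc_of% e] at hs
  simpa using hs.symm

/-- Feeding back an isomorphic copy of the unit that is left untouched does nothing. -/
theorem fbk_whiskerLeft (h : 𝟙_ D ≅ S) (u : A ⟶ B) : φ.fbk S (S ◁ u) = u := by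
  rw [← φ.fbk_conj h (whisker_exchange h.hom u), id_whiskerLeft, φ.vanishing]

/-- Sequential composition of two feedback loops is a single feedback loop on the product of the
fed back objects. -/
theorem fbk_comp_fbk (f : S ⊗ A ⟶ S ⊗ B) (g : T ⊗ B ⟶ T ⊗ C) :
    φ.fbk S f ≫ φ.fbk T g = φ.fbk (S ⊗ T) (StProc.compHom f g) := by
  have hs : ∀ X : D, (β_ S T).hom ▷ X ≫ (β_ T S).hom ▷ X = 𝟙 _ := fun X => by
    rw [← comp_whiskerRight, SymmetricCategory.symmetry, id_whiskerRight]
  rw [comp_fbk, SymmetricCategory.whiskerLeft_eq, fbk_whiskerRight, fbk_comp, comp_fbk, fbk_comp,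
    φ.joining, StProc.compHom, SymmetricCategory.whiskerLeft_eq T f]
  congr 1
  simp [reassoc_of% hs]

end FeedbackStructure

/-! ### Storing an object into the state -/

namespace StProc

section
variable {D : Type u} [Category.{v} D] [MonoidalCategory D]

/-- Regrouping of the state: the tensor factors `T` and `T'` are moved into the state. -/
def regroup {S T A S' T' B : D} (f : S ⊗ T ⊗ A ⟶ S' ⊗ T' ⊗ B) : (S ⊗ T) ⊗ A ⟶ (S' ⊗ T') ⊗ B :=
  (α_ S T A).hom ≫ f ≫ (α_ S' T' B).inv

theorem regroup_comp {S T A S' T' B S'' T'' C : D} (f : S ⊗ T ⊗ A ⟶ S' ⊗ T' ⊗ B)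
    (g : S' ⊗ T' ⊗ B ⟶ S'' ⊗ T'' ⊗ C) : regroup (f ≫ g) = regroup f ≫ regroup g := by
  simp [regroup]

theorem regroup_whiskerRight_comp {P S T A S' T' B : D} (k : P ⟶ S)
    (f : S ⊗ T ⊗ A ⟶ S' ⊗ T' ⊗ B) : regroup (k ▷ (T ⊗ A) ≫ f) = k ▷ T ▷ A ≫ regroup f := by
  simp [regroup]

theorem regroup_comp_whiskerRight {P S T A S' T' B : D} (f : S ⊗ T ⊗ A ⟶ S' ⊗ T' ⊗ B)
    (k : S' ⟶ P) : regroup (f ≫ k ▷ (T' ⊗ B)) = regroup f ≫ k ▷ T' ▷ B := by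
  simp [regroup]

/-- An action on the factor `S` of the state space is still such an action after regrouping. -/
theorem regroup_place {P X S T A B : D} (σ : P ≅ X ⊗ S) (f : S ⊗ T ⊗ A ⟶ S ⊗ T ⊗ B) :
    regroup (place σ f) = place (whiskerRightIso σ T ≪≫ α_ X S T) (regroup f) := by
  simp [regroup, place]

end

section
variable {D : Type u} [Category.{v} D] [MonoidalCategory D] [SymmetricCategory D]

/-- The process `f` run beside an idle wire `Z`, which is passed between the state and `A`. -/
def besides (Z : D) {U V A B : D} (f : U ⊗ A ⟶ V ⊗ B) : U ⊗ Z ⊗ A ⟶ V ⊗ Z ⊗ B :=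
  U ◁ (β_ Z A).hom ≫ (α_ U A Z).inv ≫ f ▷ Z ≫ (α_ V B Z).hom ≫ V ◁ (β_ B Z).hom

/-- Once the idle wire `Z` is regrouped into the state, `f` just acts on a factor of the state
space. -/
theorem regroup_besides (Z : D) {U A B : D} (f : U ⊗ A ⟶ U ⊗ B) :
    regroup (besides Z f) = place (β_ U Z) f := by
  have h : (β_ Z U).inv ▷ B ≫ (β_ U Z).inv ▷ B = 𝟙 _ := by
    rw [← comp_whiskerRight, ← SymmetricCategory.braiding_swap_eq_inv_braiding, Iso.hom_inv_id,
      id_whiskerRight]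
  rw [regroup, besides, place, SymmetricCategory.whiskerLeft_eq Z f]
  simp [SymmetricCategory.braiding_swap_eq_inv_braiding Z U, h]

theorem tensorProc_id {S A B : D} (f : S ⊗ A ⟶ S ⊗ B) (Z : D) :
    tensorProc f (𝟙 (𝟙_ D ⊗ Z)) ≫ (ρ_ S).hom ▷ (B ⊗ Z) =
      (ρ_ S).hom ▷ (A ⊗ Z) ≫ (α_ S A Z).inv ≫ f ▷ Z ≫ (α_ S B Z).hom := by
  have h : ∀ X : D, tensorμ S (𝟙_ D) X Z ≫ (S ⊗ X) ◁ (λ_ Z).hom =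
      (ρ_ S).hom ▷ (X ⊗ Z) ≫ (α_ S X Z).inv := by
    intro X
    have h : S ◁ (ρ_ X).inv ▷ Z ≫ S ◁ (α_ X (𝟙_ D) Z).hom ≫ S ◁ X ◁ (λ_ Z).hom = 𝟙 _ := by
      simp only [← whiskerLeft_comp]
      simp
    simp [tensorμ, reassoc_of% h]
  have h' : tensorδ S (𝟙_ D) B Z ≫ (ρ_ S).hom ▷ (B ⊗ Z) =
      (S ⊗ B) ◁ (λ_ Z).hom ≫ (α_ S B Z).hom := by
    rw [← cancel_epi (tensorμIso S (𝟙_ D) B Z).hom, tensorμIso_hom, tensorμ_tensorδ_assoc,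
      reassoc_of% h]
    simp
  rw [tensorProc, Category.assoc, Category.assoc, h', tensorHom_id, ← whisker_exchange_assoc,
    reassoc_of% h]

end
end StProc

namespace St
open StProc

variable {D : Type u} [Category.{v} D] [MonoidalCategory D] [SymmetricCategory D]
  {X Y Z W : St D}

theorem store_homMk (T : St D) {S : D} (f : S ⊗ T.obj ⊗ X.obj ⟶ S ⊗ T.obj ⊗ Y.obj) :
    store T (homMk (X := T ⊗ X) (Y := T ⊗ Y) S f) = homMk (S ⊗ T.obj) (regroup f) := rfl

theorem homMk_whiskerRight {S : D} (f : S ⊗ X.obj ⟶ S ⊗ Y.obj) (Z : St D) :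
    (homMk S f : X ⟶ Y) ▷ Z = homMk (X := X ⊗ Z) (Y := Y ⊗ Z) S
      ((α_ S X.obj Z.obj).inv ≫ f ▷ Z.obj ≫ (α_ S Y.obj Z.obj).hom) :=
  homMk_eq (X := X ⊗ Z) (Y := Y ⊗ Z) (ρ_ S) (tensorProc_id f Z.obj)

theorem whiskerLeft_homMk (Z : St D) {S : D} (f : S ⊗ X.obj ⟶ S ⊗ Y.obj) :
    Z ◁ (homMk S f : X ⟶ Y) = homMk (X := Z ⊗ X) (Y := Z ⊗ Y) S (besides Z.obj f) := by
  rw [SymmetricCategory.whiskerLeft_eq, homMk_whiskerRight]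
  refine ((pureHom (X := Z ⊗ X) (Y := X ⊗ Z) (β_ Z.obj X.obj).hom) ≫= homMk_pureHom (X := X ⊗ Z)
    (Y := Y ⊗ Z) (Z := Z ⊗ Y) _ (β_ Y.obj Z.obj).hom).trans ?_
  refine (pureHom_homMk (X := Z ⊗ X) (Y := X ⊗ Z) (Z := Z ⊗ Y) _ _).trans ?_
  congr 1
  simp [besides]

/-- Every stateful process is obtained by storing an object in a morphism of the base. -/
theorem homMk_eq_store {S : D} (f : S ⊗ X.obj ⟶ S ⊗ Y.obj) :
    (homMk S f : X ⟶ Y) = store ⟨S⟩ (pureHom (X := ⟨S⟩ ⊗ X) (Y := ⟨S⟩ ⊗ Y) f) := by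
  refine (homMk_eq (λ_ S) ?_).symm
  change ((α_ (𝟙_ D) S X.obj).hom ≫ 𝟙_ D ◁ f ≫ (α_ (𝟙_ D) S Y.obj).inv) ≫ _ = _
  simp

theorem comp_store (T : St D) (u : X ⟶ Y) (f : T ⊗ Y ⟶ T ⊗ Z) :
    u ≫ store T f = store T (T ◁ u ≫ f) := by
  induction u using hom_ind with
  | h U u => induction f using hom_ind with
    | h S f =>
      rw [whiskerLeft_homMk]
      refine homMk_eq (α_ U S T.obj).symm ?_
      change compHom u (regroup f) ≫ _ = _ ≫ regroup (compHom (besides T.obj u) f)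
      simp only [compHom_eq, regroup_comp, regroup_place, regroup_besides, place_place,
        reassoc_of% place_conj, place_conj, Category.assoc]
      -- What remains are equations between permutations of the state space.
      congr 2
      · ext
        simp
      · congr 1
        ext
        simp

theorem store_comp (T : St D) (f : T ⊗ X ⟶ T ⊗ Y) (v : Y ⟶ Z) :
    store T f ≫ v = store T (f ≫ T ◁ v) := by
  induction v using hom_ind with
  | h V v => induction f using hom_ind with
    | h S f =>
      rw [whiskerLeft_homMk]
      refine homMk_eq (α_ S T.obj V ≪≫ whiskerLeftIso S (β_ T.obj V) ≪≫ (α_ S V T.obj).symm) ?_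
      change compHom (regroup f) v ≫ _ = _ ≫ regroup (compHom f (besides T.obj v))
      simp only [compHom_eq, regroup_comp, regroup_place, regroup_besides, place_place,
        reassoc_of% place_conj, place_conj, Category.assoc]
      -- What remains are equations between permutations of the state space.
      congr 2
      · ext
        simp
      · congr 1
        ext
        simp [← whiskerLeft_comp_assoc]

theorem store_vanishing (f : X ⟶ Y) : store (𝟙_ (St D)) ((λ_ X).hom ≫ f ≫ (λ_ Y).inv) = f := by
  induction f using hom_ind with
  | h S f =>
    refine (congrArg (store (𝟙_ (St D))) ((_ ≫= homMk_pureHom (Z := 𝟙_ (St D) ⊗ Y) f _).trans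
      (pureHom_homMk (X := 𝟙_ (St D) ⊗ X) (Z := 𝟙_ (St D) ⊗ Y) _ _))).trans ?_
    refine homMk_eq (ρ_ S) ?_
    change regroup (S ◁ (λ_ X.obj).hom ≫ f ≫ S ◁ (λ_ Y.obj).inv) ≫ _ = _
    simp [regroup]

theorem store_joining (S T : St D) (f : S ⊗ T ⊗ X ⟶ S ⊗ T ⊗ Y) :
    store T (store S f) = store (S ⊗ T) ((α_ S T X).hom ≫ f ≫ (α_ S T Y).inv) := by
  induction f using hom_ind with
  | h R f =>
    refine Eq.trans ?_ (congrArg (store (S ⊗ T)) ((_ ≫= homMk_pureHom (Y := S ⊗ T ⊗ Y)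
      (Z := (S ⊗ T) ⊗ Y) f _).trans
      (pureHom_homMk (X := (S ⊗ T) ⊗ X) (Y := S ⊗ T ⊗ X) (Z := (S ⊗ T) ⊗ Y) _ _))).symm
    refine homMk_eq (α_ R S.obj T.obj) ?_
    change regroup (regroup f) ≫ _ =
      _ ≫ regroup (R ◁ (α_ S.obj T.obj X.obj).hom ≫ f ≫ R ◁ (α_ S.obj T.obj Y.obj).inv)
    simp [regroup]

theorem store_whiskerRight (S : St D) (f : S ⊗ X ⟶ S ⊗ Y) (Z : St D) :
    store S f ▷ Z = store S ((α_ S X Z).inv ≫ f ▷ Z ≫ (α_ S Y Z).hom) := by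
  induction f using hom_ind with
  | h R f =>
    rw [store_homMk, homMk_whiskerRight, homMk_whiskerRight]
    refine Eq.trans ?_ (congrArg (store S) ((_ ≫= homMk_pureHom (X := (S ⊗ X) ⊗ Z)
      (Y := (S ⊗ Y) ⊗ Z) (Z := S ⊗ Y ⊗ Z) _ _).trans
      (pureHom_homMk (X := S ⊗ X ⊗ Z) (Y := (S ⊗ X) ⊗ Z) (Z := S ⊗ Y ⊗ Z) _ _))).symm
    refine homMk_eq (Iso.refl _) ?_
    change _ = _ ≫ regroup (R ◁ (α_ S.obj X.obj Z.obj).inv ≫ ((α_ R (S.obj ⊗ X.obj) Z.obj).inv ≫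
      f ▷ Z.obj ≫ (α_ R (S.obj ⊗ Y.obj) Z.obj).hom) ≫ R ◁ (α_ S.obj Y.obj Z.obj).hom)
    simp [regroup]

theorem store_strength (S : St D) (f : S ⊗ X ⟶ S ⊗ Y) (g : Z ⟶ W) :
    store S f ⊗ₘ g = store S ((α_ S X Z).inv ≫ (f ⊗ₘ g) ≫ (α_ S Y W).hom) := by
  rw [MonoidalCategory.tensorHom_def, store_whiskerRight, store_comp,
    MonoidalCategory.tensorHom_def]
  simp

/-- An isomorphism of stateful processes is represented by an isomorphism of the base, although its
state space `U` need not be trivial. The state space is invertible, with inverse the state space `V`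
of the inverse process, so it suffices that `V ◁ h` is an isomorphism. -/
theorem isIso_of_iso {U : D} {h : U ⊗ X.obj ⟶ U ⊗ Y.obj} (e : X ≅ Y) (he : e.hom = homMk U h) :
    IsIso h := by
  obtain ⟨V, k, hk⟩ : ∃ (V : D) (k : V ⊗ Y.obj ⟶ V ⊗ X.obj), e.inv = homMk V k := by
    generalize e.inv = q
    induction q using hom_ind with
    | h V k => exact ⟨V, k, rfl⟩
  have h₁ := e.hom_inv_id
  have h₂ := e.inv_hom_id
  rw [he, hk] at h₁ h₂
  obtain ⟨i₁, e₁⟩ := StProc.exists_iso (Quotient.exact h₁)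
  obtain ⟨i₂, e₂⟩ := StProc.exists_iso (Quotient.exact h₂)
  have w₁ : compHom h k = 𝟙 _ := by
    rw [← cancel_mono (i₁.hom ▷ X.obj), e₁]
    simp
  have w₂ : compHom k h = 𝟙 _ := by
    rw [← cancel_mono (i₂.hom ▷ Y.obj), e₂]
    simp
  -- The two actions on `(U ⊗ V) ⊗ -` are mutually inverse.
  have w₃ : place (Iso.refl (U ⊗ V)) k ≫ place (β_ U V) h = 𝟙 _ := by
    rw [compHom_eq, ← cancel_epi ((β_ U V).hom ▷ Y.obj), reassoc_of% place_conj, place_conj] at w₂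
    rw [← cancel_mono ((β_ U V).hom ▷ Y.obj)]
    have hβ : β_ U V ≪≫ β_ V U = Iso.refl _ := by
      ext
      simp
    simpa [hβ] using w₂
  have i : IsIso (place (β_ U V) h) := ⟨_, (compHom_eq h k).symm.trans w₁, w₃⟩
  have i' : IsIso (V ◁ h) := by
    have : V ◁ h = (α_ V U _).inv ≫ ((β_ U V).inv ▷ _ ≫ place (β_ U V) h ≫ (β_ U V).hom ▷ _) ≫
        (α_ V U _).hom := by simp [place]
    rw [this]
    infer_instance
  have i'' : IsIso ((U ⊗ V) ◁ h) := by
    rw [tensor_whiskerLeft]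
    infer_instance
  have : h = (λ_ _).inv ≫ (i₁.inv ▷ _ ≫ (U ⊗ V) ◁ h ≫ i₁.hom ▷ _) ≫ (λ_ _).hom := by
    rw [← whisker_exchange_assoc]
    simp
  rw [this]
  infer_instance

theorem store_sliding {S T : St D} (f : T ⊗ X ⟶ S ⊗ Y) (e : S ≅ T) :
    store T (f ≫ e.hom ▷ Y) = store S (e.hom ▷ X ≫ f) := by
  obtain ⟨U, h, he⟩ : ∃ (U : D) (h : U ⊗ S.obj ⟶ U ⊗ T.obj), e.hom = homMk U h := by
    generalize e.hom = q
    induction q using hom_ind with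
    | h V k => exact ⟨V, k, rfl⟩
  have := isIso_of_iso e he
  rw [he]
  induction f using hom_ind with
  | h R f =>
    rw [homMk_whiskerRight, homMk_whiskerRight]
    let H : (R ⊗ U) ⊗ S.obj ≅ (R ⊗ U) ⊗ T.obj :=
      α_ R U S.obj ≪≫ whiskerLeftIso R (asIso h) ≪≫ (α_ R U T.obj).symm
    have hH : ∀ A : D, regroup (place (Iso.refl (R ⊗ U))
        ((α_ U S.obj A).inv ≫ h ▷ A ≫ (α_ U T.obj A).hom)) = H.hom ▷ A := fun A => by
      simp [H, place, regroup]
    refine homMk_eq (Y := Y) (H.symm ≪≫ whiskerRightIso (β_ R U) S.obj) ?_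
    change regroup (compHom f _) ≫ _ = _ ≫ regroup (compHom _ f)
    have hβ : β_ R U ≪≫ β_ U R = Iso.refl _ := by
      ext
      simp
    -- Both sides run `h` and `f` on `(R ⊗ U) ⊗ -`, up to the isomorphism `H`.
    have key : (β_ R U).hom ▷ S.obj ▷ X.obj ≫ regroup (compHom
        ((α_ U S.obj X.obj).inv ≫ h ▷ X.obj ≫ (α_ U T.obj X.obj).hom) f) =
        H.hom ▷ X.obj ≫ regroup (place (β_ R U) f) ≫ (β_ R U).hom ▷ S.obj ▷ Y.obj := by
      rw [← regroup_whiskerRight_comp, compHom_eq, reassoc_of% place_conj, place_conj, hβ,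
        regroup_comp, hH, Iso.trans_refl, regroup_comp_whiskerRight]
    rw [compHom_eq, regroup_comp, hH]
    simp only [Iso.trans_hom, Iso.symm_hom, whiskerRightIso_hom, comp_whiskerRight, Category.assoc,
      key]
    simp

/-- Storing an object into the state is a feedback operator. -/
def feedback (D : Type u) [Category.{v} D] [MonoidalCategory D] [SymmetricCategory D] :
    FeedbackStructure (St D) where
  fbk S _ _ f := store S f
  tightening S _ _ _ _ u f v := by rw [store_comp, comp_store]
  vanishing := store_vanishing
  joining S T _ _ f := store_joining S T f
  strength S _ _ _ _ f g := store_strength S f g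
  sliding := store_sliding

end St

/-! ### The free feedback category -/

namespace SymMonFunctor
open Functor.LaxMonoidal Functor.OplaxMonoidal StProc

variable {D : Type u₁} [Category.{v₁} D] [MonoidalCategory D] [SymmetricCategory D]
  {X : Type u₂} [Category.{v₂} X] [MonoidalCategory X] [SymmetricCategory X]
  (F : SymMonFunctor D X)

/-- The image under `F` of a morphism between tensor products, transported along the structure
isomorphisms of `F`. -/
def transport {S A S' B : D} (f : S ⊗ A ⟶ S' ⊗ B) :
    F.toFunctor.obj S ⊗ F.toFunctor.obj A ⟶ F.toFunctor.obj S' ⊗ F.toFunctor.obj B :=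
  μ F.toFunctor S A ≫ F.toFunctor.map f ≫ δ F.toFunctor S' B

theorem transport_comp {S A S' B S'' C : D} (f : S ⊗ A ⟶ S' ⊗ B) (g : S' ⊗ B ⟶ S'' ⊗ C) :
    F.transport (f ≫ g) = F.transport f ≫ F.transport g := by
  simp [transport]

theorem transport_whiskerLeft (S : D) {A B : D} (u : A ⟶ B) :
    F.transport (S ◁ u) = F.toFunctor.obj S ◁ F.toFunctor.map u := by
  rw [transport, Functor.Monoidal.map_whiskerLeft]
  simp only [Category.assoc, Functor.Monoidal.μ_δ, Functor.Monoidal.μ_δ_assoc, Category.comp_id]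

theorem transport_whiskerRight {S T : D} (h : S ⟶ T) (A : D) :
    F.transport (h ▷ A) = F.toFunctor.map h ▷ F.toFunctor.obj A := by
  rw [transport, Functor.Monoidal.map_whiskerRight]
  simp only [Category.assoc, Functor.Monoidal.μ_δ, Functor.Monoidal.μ_δ_assoc, Category.comp_id]

theorem transport_associator_hom (S T A : D) :
    F.transport (α_ S T A).hom = δ F.toFunctor S T ▷ F.toFunctor.obj A ≫ (α_ _ _ _).hom ≫
      F.toFunctor.obj S ◁ μ F.toFunctor T A := by
  rw [transport, Functor.Monoidal.map_associator]
  simp only [Category.assoc, Functor.Monoidal.μ_δ, Functor.Monoidal.μ_δ_assoc, Category.comp_id]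

theorem transport_associator_inv (S T A : D) :
    F.transport (α_ S T A).inv = F.toFunctor.obj S ◁ δ F.toFunctor T A ≫ (α_ _ _ _).inv ≫
      μ F.toFunctor S T ▷ F.toFunctor.obj A := by
  rw [transport, Functor.Monoidal.map_associator_inv]
  simp only [Category.assoc, Functor.Monoidal.μ_δ, Functor.Monoidal.μ_δ_assoc, Category.comp_id]

theorem whiskerLeft_μ_comp_transport (Z : D) {S A S' B : D} (f : S ⊗ A ⟶ S' ⊗ B) :
    F.toFunctor.obj Z ◁ μ F.toFunctor S A ≫ F.transport (Z ◁ f) =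
      F.toFunctor.obj Z ◁ F.transport f ≫ F.toFunctor.obj Z ◁ μ F.toFunctor S' B := by
  rw [transport, transport, Functor.Monoidal.map_whiskerLeft]
  simp only [Category.assoc, Functor.Monoidal.μ_δ, Functor.Monoidal.μ_δ_assoc, Category.comp_id,
    whiskerLeft_comp, Functor.Monoidal.whiskerLeft_δ_μ]

theorem transport_whiskerRight_of_tensor {S A S' B : D} (f : S ⊗ A ⟶ S' ⊗ B) (Z : D) :
    F.transport (f ▷ Z) = δ F.toFunctor S A ▷ F.toFunctor.obj Z ≫
      F.transport f ▷ F.toFunctor.obj Z ≫ μ F.toFunctor S' B ▷ F.toFunctor.obj Z := by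
  rw [transport, transport, Functor.Monoidal.map_whiskerRight]
  simp only [Category.assoc, Functor.Monoidal.μ_δ, Functor.Monoidal.μ_δ_assoc, Category.comp_id,
    comp_whiskerRight, Functor.Monoidal.whiskerRight_δ_μ, Functor.Monoidal.whiskerRight_δ_μ_assoc]

/-- A symmetric strong monoidal functor preserves the action on a tensor factor. -/
theorem transport_place {P Y S A B : D} (σ : P ≅ Y ⊗ S) (f : S ⊗ A ⟶ S ⊗ B) :
    F.transport (place σ f) = place (F.toFunctor.mapIso σ ≪≫
      (Functor.Monoidal.μIso F.toFunctor Y S).symm) (F.transport f) := by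
  simp only [place, transport_comp, transport_whiskerRight, transport_associator_hom,
    transport_associator_inv, Category.assoc, reassoc_of% F.whiskerLeft_μ_comp_transport Y f]
  simp

theorem transport_compHom {S T A B C : D} (f : S ⊗ A ⟶ S ⊗ B) (g : T ⊗ B ⟶ T ⊗ C) :
    compHom (F.transport f) (F.transport g) ≫ (Functor.Monoidal.μIso F.toFunctor S T).hom ▷ _ =
      (Functor.Monoidal.μIso F.toFunctor S T).hom ▷ _ ≫ F.transport (compHom f g) := by
  rw [compHom_eq, compHom_eq, transport_comp, transport_place, transport_place,
    reassoc_of% place_conj, place_conj, Category.assoc]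
  congr 2
  · ext
    simp
  · congr 1
    ext
    simp

variable {F} (ψ : FeedbackStructure X)

/-- The value on stateful processes of the feedback functor extending `F`: a process `(S ∣ f)` is
sent to the feedback of `F f` along `F S`. -/
def extendMap (F : SymMonFunctor D X) {A B : St D} :
    (A ⟶ B) → (F.toFunctor.obj A.obj ⟶ F.toFunctor.obj B.obj) :=
  Quotient.lift (fun P => ψ.fbk (F.toFunctor.obj P.state) (F.transport P.hom)) (by
    rintro ⟨S, f⟩ ⟨T, g⟩ h
    obtain ⟨h, e⟩ := StProc.exists_iso h
    refine ψ.fbk_conj (F.toFunctor.mapIso h) ?_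
    simp only [Functor.mapIso_hom, ← transport_whiskerRight, ← transport_comp, e])

theorem extendMap_homMk {A B : St D} {S : D} (f : S ⊗ A.obj ⟶ S ⊗ B.obj) :
    extendMap ψ F (St.homMk S f : A ⟶ B) = ψ.fbk (F.toFunctor.obj S) (F.transport f) := rfl

theorem extendMap_pureHom {A B : St D} (u : A.obj ⟶ B.obj) :
    extendMap ψ F (St.pureHom u : A ⟶ B) = F.toFunctor.map u := by
  rw [St.pureHom, extendMap_homMk, transport_whiskerLeft]
  exact ψ.fbk_whiskerLeft (Functor.Monoidal.εIso F.toFunctor) _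

/-- The functor underlying the feedback functor that extends `F` to stateful processes. -/
def extendFunctor (F : SymMonFunctor D X) : St D ⥤ X where
  obj A := F.toFunctor.obj A.obj
  map := extendMap ψ F
  map_id A := by rw [← St.pureHom_id, extendMap_pureHom, CategoryTheory.Functor.map_id]
  map_comp {A B C} f g := by
    induction f using St.hom_ind with
    | h S f => induction g using St.hom_ind with
      | h T g =>
        rw [St.homMk_comp, extendMap_homMk, extendMap_homMk, extendMap_homMk, ψ.fbk_comp_fbk]
        exact (ψ.fbk_conj _ (F.transport_compHom f g)).symm

/-- The feedback functor that extends `F` to stateful processes. -/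
def extend (F : SymMonFunctor D X) : SymMonFunctor (St D) X where
  toFunctor := extendFunctor ψ F
  braided := .ofNaturalLeft (extendFunctor ψ F) (Functor.Monoidal.εIso F.toFunctor)
    (fun A B => Functor.Monoidal.μIso F.toFunctor A.obj B.obj)
    (fun {A B} f Z => by
      induction f using St.hom_ind with
      | h S f =>
        rw [St.homMk_whiskerRight]
        change ψ.fbk (F.toFunctor.obj S) (F.transport f) ▷ F.toFunctor.obj Z.obj ≫
            μ F.toFunctor B.obj Z.obj =
          μ F.toFunctor A.obj Z.obj ≫ ψ.fbk (F.toFunctor.obj S) (F.transport _)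
        rw [ψ.fbk_whiskerRight, ψ.fbk_comp, ψ.comp_fbk]
        congr 1
        rw [transport_comp, transport_comp, transport_associator_inv, transport_associator_hom,
          transport_whiskerRight_of_tensor]
        simp)
    (fun A B Z => by
      refine Eq.trans ?_ (Functor.LaxMonoidal.associativity F.toFunctor A.obj B.obj Z.obj)
      exact congrArg (fun a => μ F.toFunctor A.obj B.obj ▷ F.toFunctor.obj Z.obj ≫
        μ F.toFunctor (A.obj ⊗ B.obj) Z.obj ≫ a) (extendMap_pureHom ψ _))
    (fun A => by
      refine (Functor.LaxMonoidal.left_unitality F.toFunctor A.obj).trans ?_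
      exact congrArg (fun a => ε F.toFunctor ▷ F.toFunctor.obj A.obj ≫
        μ F.toFunctor (𝟙_ D) A.obj ≫ a) (extendMap_pureHom ψ _).symm)
    (fun A B => by
      refine Eq.trans ?_ (Functor.LaxBraided.braided (F := F.toFunctor) A.obj B.obj)
      exact congrArg (fun a => μ F.toFunctor A.obj B.obj ≫ a) (extendMap_pureHom ψ _))

theorem extend_preservesFeedback (F : SymMonFunctor D X) :
    (extend ψ F).PreservesFeedback (St.feedback D) ψ := by
  intro S A B f
  induction f using St.hom_ind with
  | h R f =>
    change ψ.fbk (F.toFunctor.obj (R ⊗ S.obj)) (F.transport (regroup f)) = ψ.fbk _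
      (μ F.toFunctor S.obj A.obj ≫ ψ.fbk (F.toFunctor.obj R) (F.transport f) ≫
        δ F.toFunctor S.obj B.obj)
    rw [ψ.tightening, ψ.joining]
    refine (ψ.fbk_conj (Functor.Monoidal.μIso F.toFunctor R S.obj) ?_).symm
    simp [regroup, transport_comp, transport_associator_inv, transport_associator_hom]

theorem inclusion_comp_extend (F : SymMonFunctor D X) :
    (St.inclusion D).comp (extend ψ F) = F := by
  refine SymMonFunctor.ext (Functor.hext (fun _ => rfl) fun A B u =>
    heq_of_eq (extendMap_pureHom (A := ⟨A⟩) (B := ⟨B⟩) ψ u)) (heq_of_eq ?_)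
    fun A B => heq_of_eq ?_
  · change ε F.toFunctor ≫ (extendFunctor ψ F).map (𝟙 _) = ε F.toFunctor
    rw [CategoryTheory.Functor.map_id]
    exact Category.comp_id _
  · change μ F.toFunctor A B ≫ (extendFunctor ψ F).map (𝟙 _) = μ F.toFunctor A B
    rw [CategoryTheory.Functor.map_id]
    exact Category.comp_id _

/-- A feedback functor on stateful processes is determined by its restriction to the base. -/
theorem extend_inclusion_comp (G : SymMonFunctor (St D) X)
    (hG : G.PreservesFeedback (St.feedback D) ψ) : extend ψ ((St.inclusion D).comp G) = G := by
  refine SymMonFunctor.ext (Functor.hext (fun _ => rfl) fun A B u => heq_of_eq ?_) (heq_of_eq ?_)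
    fun A B => heq_of_eq ?_
  · induction u using St.hom_ind with
    | h S f =>
      rw [congrArg G.toFunctor.map (St.homMk_eq_store f)]
      refine Eq.trans ?_ (hG ⟨S⟩ (A := A) (B := B) (St.pureHom f)).symm
      refine congrArg (ψ.fbk (G.toFunctor.obj ⟨S⟩)) ?_
      change (μ G.toFunctor ⟨S⟩ A ≫ G.toFunctor.map (𝟙 _)) ≫ G.toFunctor.map (St.pureHom f) ≫
        (G.toFunctor.map (𝟙 _) ≫ δ G.toFunctor ⟨S⟩ B) = _
      simp only [CategoryTheory.Functor.map_id]
      rw [Category.comp_id, Category.id_comp]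
  · change ε G.toFunctor ≫ G.toFunctor.map (𝟙 _) = ε G.toFunctor
    rw [CategoryTheory.Functor.map_id]
    exact Category.comp_id _
  · change μ G.toFunctor A B ≫ G.toFunctor.map (𝟙 _) = μ G.toFunctor A B
    rw [CategoryTheory.Functor.map_id]
    exact Category.comp_id _

end SymMonFunctor

/-- Stateful processes over any symmetric monoidal category `D` form the free feedback category over
`D`. -/
theorem St.isFreeFeedbackCategory (D : Type u₁) [Category.{v₁} D] [MonoidalCategory D]
    [SymmetricCategory D] :
    IsFreeFeedbackCategory.{_, _, v₃, _, _, u₃} (St.feedback D) (St.inclusion D) := by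
  intro X _ _ _ ψ F
  refine ⟨F.extend ψ, ⟨F.extend_preservesFeedback ψ, F.inclusion_comp_extend ψ⟩, ?_⟩
  rintro G ⟨hG, rfl⟩
  exact (G.extend_inclusion_comp ψ hG).symm

/-! ### Isomorphisms of spans -/

namespace SpanCat

/-- The projection `p` is a split epimorphism, as a base change of `l'`, and a split monomorphism,
as a factor of `p ≫ l`. -/
theorem isIso_of_isPullback {C : Type u} [Category.{v} C] {P E F A B : C}
    {p : P ⟶ E} {q : P ⟶ F} {r : E ⟶ B} {l' : F ⟶ B}
    (h : IsPullback p q r l') (l : E ⟶ A) [IsIso (p ≫ l)] [IsSplitEpi l'] : IsIso l := by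
  have : IsSplitEpi p := ⟨⟨⟨h.lift (𝟙 E) (r ≫ section_ l') (by simp), by simp⟩⟩⟩
  have : IsSplitMono p := ⟨⟨⟨l ≫ inv (p ≫ l), by simp [← Category.assoc]⟩⟩⟩
  have : IsIso p := isIso_of_epi_of_isSplitMono p
  exact IsIso.of_isIso_comp_left p l

section
variable {C : Type u} [Category.{v} C] [HasPullbacks C] {X Y Z W : SpanCat C}

theorem homMk_eq_iff {E E' : C} {l : E ⟶ X.obj} {r : E ⟶ Y.obj} {l' : E' ⟶ X.obj}
    {r' : E' ⟶ Y.obj} : (homMk E l r : X ⟶ Y) = homMk E' l' r' ↔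
      ∃ e : E ≅ E', e.hom ≫ l' = l ∧ e.hom ≫ r' = r := by
  refine ⟨fun h => ?_, fun ⟨e, hl, hr⟩ => homMk_eq e hl hr⟩
  obtain ⟨e⟩ := Quotient.exact h
  exact ⟨⟨e.hom.hom, e.inv.hom, hom_inv_apex e, inv_hom_apex e⟩, e.hom.hom_l, e.hom.hom_r⟩

theorem graphHom_comp_homMk_comp_graphHom (u : X.obj ≅ Y.obj) {E : C}
    (l : E ⟶ Y.obj) (r : E ⟶ Z.obj) (w : Z.obj ⟶ W.obj) :
    (graphHom u.hom : X ⟶ Y) ≫ (homMk E l r : Y ⟶ Z) ≫ (graphHom w : Z ⟶ W) =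
      homMk E (l ≫ u.inv) (r ≫ w) := by
  rw [homMk_graphHom, graphHom_homMk]

/-- An invertible span is the graph of an isomorphism of the base. -/
theorem exists_graphHom_eq_hom (e : X ≅ Y) : ∃ u : X.obj ≅ Y.obj, e.hom = graphHom u.hom := by
  obtain ⟨f, g, hfg, hgf⟩ := e
  induction f using hom_ind with
  | h E l r => induction g using hom_ind with
    | h F l' r' =>
      have h₁ := IsPullback.of_hasPullback r l'
      have h₂ := IsPullback.of_hasPullback r' l
      rw [homMk_comp h₁, id_def] at hfg
      rw [homMk_comp h₂, id_def] at hgf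
      obtain ⟨i, hi, hi'⟩ := homMk_eq_iff.1 hfg
      obtain ⟨j, hj, hj'⟩ := homMk_eq_iff.1 hgf
      rw [Category.comp_id] at hi hi' hj hj'
      have : IsIso (pullback.fst r l' ≫ l) := hi ▸ inferInstance
      have : IsIso (pullback.snd r' l ≫ r) := hj' ▸ inferInstance
      have : IsSplitEpi l' := ⟨⟨⟨j.inv ≫ pullback.fst r' l, by rw [Category.assoc, ← hj]; simp⟩⟩⟩
      have : IsSplitEpi r' := ⟨⟨⟨i.inv ≫ pullback.snd r l', by rw [Category.assoc, ← hi']; simp⟩⟩⟩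
      have := isIso_of_isPullback h₁ l
      have := isIso_of_isPullback h₂.flip r
      refine ⟨(asIso l).symm ≪≫ asIso r, ?_⟩
      exact homMk_eq (asIso l) (by simp) (by simp)

end

/-! ### Stateful processes over spans -/

/-- The edges of a sequential composite are the composable pairs of edges. -/
theorem isPullback_compHom {C : Type u} [Category.{v} C] [CartesianMonoidalCategory C]
    {B S T E F P : C} {r : E ⟶ S ⊗ B} {l : F ⟶ T ⊗ B}
    {p : P ⟶ E} {q : P ⟶ F} (h : IsPullback p q (r ≫ snd _ _) (l ≫ snd _ _)) :
    IsPullback (lift (q ≫ l ≫ fst _ _) p) (lift (p ≫ r ≫ fst _ _) q)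
      (T ◁ r ≫ (α_ T S B).inv ≫ (swap S T).inv ▷ B)
      (S ◁ l ≫ (α_ S T B).inv ≫ 𝟙 (S ⊗ T) ▷ B) := by
  refine ⟨⟨?_⟩, ⟨PullbackCone.IsLimit.mk _
    (fun s => h.lift (s.fst ≫ snd _ _) (s.snd ≫ snd _ _) ?_) ?_ ?_ ?_⟩⟩
  · ext <;> simp [h.w]
  · simpa using s.condition =≫ snd _ _
  · intro s
    have h₁ := (s.condition =≫ fst _ _) =≫ snd _ _
    ext <;> simp
    simpa using h₁.symm
  · intro s
    have h₁ := (s.condition =≫ fst _ _) =≫ fst _ _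
    ext <;> simp
    simpa using h₁
  · intro s m hm hm'
    apply h.hom_ext <;> simp [← hm, ← hm']

section
variable {C : Type u} [Category.{v} C] [HasPullbacks C] [CartesianMonoidalCategory C]
  {X Y Z S T P : SpanCat C}

theorem whiskerLeft_homMk (X : SpanCat C) {E : C} (l : E ⟶ Y.obj) (r : E ⟶ Z.obj) :
    X ◁ (homMk E l r : Y ⟶ Z) =
      homMk (X := X ⊗ Y) (Y := X ⊗ Z) (X.obj ⊗ E) (X.obj ◁ l) (X.obj ◁ r) := by
  rw [← MonoidalCategory.id_tensorHom, id_def, homMk_tensorHom]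
  simp only [MonoidalCategory.id_tensorHom]

theorem homMk_whiskerRight {E : C} (l : E ⟶ Y.obj) (r : E ⟶ Z.obj) (X : SpanCat C) :
    (homMk E l r : Y ⟶ Z) ▷ X =
      homMk (X := Y ⊗ X) (Y := Z ⊗ X) (E ⊗ X.obj) (l ▷ X.obj) (r ▷ X.obj) := by
  rw [← MonoidalCategory.tensorHom_id, id_def, homMk_tensorHom]
  simp only [MonoidalCategory.tensorHom_id]

/-- The action of a span on a factor of the state space, as an explicit span. -/
theorem place_homMk (σ : P.obj ≅ X.obj ⊗ S.obj) {E : C} (l : E ⟶ S.obj ⊗ Y.obj)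
    (r : E ⟶ S.obj ⊗ Z.obj) :
    StProc.place (graphIso (X := P) (Y := X ⊗ S) σ)
        (homMk (X := S ⊗ Y) (Y := S ⊗ Z) E l r) =
      homMk (X := P ⊗ Y) (Y := P ⊗ Z) (X.obj ⊗ E)
        (X.obj ◁ l ≫ (α_ X.obj S.obj Y.obj).inv ≫ σ.inv ▷ Y.obj)
        (X.obj ◁ r ≫ (α_ X.obj S.obj Z.obj).inv ≫ σ.inv ▷ Z.obj) := by
  have h := graphHom_comp_homMk_comp_graphHom (X := P ⊗ Y) (Y := X ⊗ S ⊗ Y) (Z := X ⊗ S ⊗ Z)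
    (W := P ⊗ Z) (whiskerRightIso σ Y.obj ≪≫ α_ X.obj S.obj Y.obj) (X.obj ◁ l) (X.obj ◁ r)
    ((α_ X.obj S.obj Z.obj).inv ≫ σ.inv ▷ Z.obj)
  rw [StProc.place, whiskerLeft_homMk, graphIso_hom, graphIso_inv, graphHom_whiskerRight,
    graphHom_whiskerRight]
  refine Eq.trans ?_ (h.trans ?_)
  · simp only [Iso.trans_hom, whiskerRightIso_hom]
    rw [graphHom_comp (Y := (X ⊗ S) ⊗ Y), graphHom_comp (Y := (X ⊗ S) ⊗ Z), Category.assoc]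
    rfl
  · simp

/-- A composite of stateful processes over spans, computed by a pullback over the exchanged object
`Y` alone. -/
theorem compHom_homMk {E F R : C} {l : E ⟶ S.obj ⊗ X.obj}
    {r : E ⟶ S.obj ⊗ Y.obj} {l' : F ⟶ T.obj ⊗ Y.obj} {r' : F ⟶ T.obj ⊗ Z.obj}
    {p : R ⟶ E} {q : R ⟶ F} (h : IsPullback p q (r ≫ snd _ _) (l' ≫ snd _ _)) :
    StProc.compHom (homMk (X := S ⊗ X) (Y := S ⊗ Y) E l r)
        (homMk (X := T ⊗ Y) (Y := T ⊗ Z) F l' r') =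
      homMk (X := (S ⊗ T) ⊗ X) (Y := (S ⊗ T) ⊗ Z) R
        (lift (lift (p ≫ l ≫ fst _ _) (q ≫ l' ≫ fst _ _)) (p ≫ l ≫ snd _ _))
        (lift (lift (p ≫ r ≫ fst _ _) (q ≫ r' ≫ fst _ _)) (q ≫ r' ≫ snd _ _)) := by
  have e₁ := place_homMk (P := S ⊗ T) (X := T) (S := S) (swap S.obj T.obj) l r
  have e₂ := place_homMk (P := S ⊗ T) (X := S) (S := T) (Iso.refl _) l' r'
  have e₃ : graphIso (X := S ⊗ T) (Y := S ⊗ T) (Iso.refl _) = Iso.refl _ := rfl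
  rw [e₃] at e₂
  rw [StProc.compHom_eq]
  refine (congrArg₂ (· ≫ ·) e₁ e₂).trans ?_
  have hl : lift (q ≫ l' ≫ fst _ _) p ≫ T.obj ◁ l ≫ (α_ T.obj S.obj X.obj).inv ≫
      (swap S.obj T.obj).inv ▷ X.obj =
      lift (lift (p ≫ l ≫ fst _ _) (q ≫ l' ≫ fst _ _)) (p ≫ l ≫ snd _ _) := by
    ext <;> simp
  have hr : lift (p ≫ r ≫ fst _ _) q ≫ S.obj ◁ r' ≫ (α_ S.obj T.obj Z.obj).inv ≫
      (Iso.refl (S.obj ⊗ T.obj)).inv ▷ Z.obj =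
      lift (lift (p ≫ r ≫ fst _ _) (q ≫ r' ≫ fst _ _)) (q ≫ r' ≫ snd _ _) := by
    ext <;> simp
  exact (homMk_comp (X := (S ⊗ T) ⊗ X) (Y := (S ⊗ T) ⊗ Y) (Z := (S ⊗ T) ⊗ Z)
    (isPullback_compHom h)).trans (congrArg₂ (homMk (X := (S ⊗ T) ⊗ X) (Y := (S ⊗ T) ⊗ Z) R) hl hr)

end
end SpanCat

/-! ### Internal graphs over a graph with one vertex -/

section
open WalkingParallelPair WalkingParallelPairHom

theorem internalGraph_hom_ext {C : Type u} [Category.{v} C] {G H : InternalGraph C} {f g : G ⟶ H}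
    (h₀ : f.app zero = g.app zero) (h₁ : f.app one = g.app one) : f = g := by
  ext (_ | _)
  exacts [h₀, h₁]

variable {C : Type u} [Category.{v} C] [CartesianMonoidalCategory C]

/-- The morphism of graphs to `A ⇉ 1` that labels the edges by `l`. -/
def toBouquet {G : InternalGraph C} {A : C} (l : G.obj zero ⟶ A) : G ⟶ bouquet A :=
  parallelPairHomMk l (toUnit (G.obj one)) (toUnit_unique _ _) (toUnit_unique _ _)

/-- A morphism to a graph with one vertex is determined by its value on edges. -/
theorem bouquet_hom_ext {G : InternalGraph C} {A : C} {f g : G ⟶ bouquet A}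
    (h : f.app zero = g.app zero) : f = g :=
  internalGraph_hom_ext h (toUnit_unique _ _)

/-- The morphism of graphs from `A ⇉ 1` to `B ⇉ 1` induced by a morphism of the base. -/
abbrev bouquetMap {A B : C} (u : A ⟶ B) : bouquet A ⟶ bouquet B :=
  toBouquet (G := bouquet A) u

/-- The product of two graphs with one vertex has one vertex; on edges the comparison is the
identity. -/
def bouquetTensor (A B : C) : bouquet A ⊗ bouquet B ≅ bouquet (A ⊗ B) :=
  parallelPair.ext (Iso.refl (A ⊗ B)) (λ_ (𝟙_ C)) (toUnit_unique _ _) (toUnit_unique _ _)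

/-- The terminal graph has one edge and one vertex. -/
def bouquetUnit (C : Type u) [Category.{v} C] [CartesianMonoidalCategory C] :
    𝟙_ (InternalGraph C) ≅ bouquet (𝟙_ C) :=
  parallelPair.ext (Iso.refl (𝟙_ C)) (Iso.refl (𝟙_ C)) (toUnit_unique _ _) (toUnit_unique _ _)

/-- The edges of a pullback over a graph with one vertex are the pairs of edges with the same label;
its vertices are arbitrary pairs of vertices. -/
theorem isPullback_bouquet {C : Type u} [Category.{v} C] [CartesianMonoidalCategory C]
    [HasPullbacks C] {A E V F W P : C} {s t : E ⟶ V} {s' t' : F ⟶ W}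
    {r : E ⟶ A} {l : F ⟶ A} {p : P ⟶ E} {q : P ⟶ F} (h : IsPullback p q r l) :
    IsPullback
      (parallelPairHom (lift (p ≫ s) (q ≫ s')) (lift (p ≫ t) (q ≫ t')) s t p (fst V W)
        (by simp) (by simp))
      (parallelPairHom (lift (p ≫ s) (q ≫ s')) (lift (p ≫ t) (q ≫ t')) s' t' q (snd V W)
        (by simp) (by simp))
      (toBouquet (G := parallelPair s t) r) (toBouquet (G := parallelPair s' t') l) := by
  refine IsPullback.of_forall_isPullback_app ?_
  rintro (_ | _)
  · exact h
  · refine ⟨⟨toUnit_unique _ _⟩, ⟨PullbackCone.IsLimit.mk _ (fun c => lift c.fst c.snd)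
      (fun c => lift_fst _ _) (fun c => lift_snd _ _) fun c m hm hm' => ?_⟩⟩
    exact CartesianMonoidalCategory.hom_ext _ _ (hm.trans (lift_fst _ _).symm)
      (hm'.trans (lift_snd _ _).symm)

end

/-! ### Spans of graphs with one vertex -/

namespace SpanCat
section
variable {C : Type u} [Category.{v} C] [HasPullbacks C] [CartesianMonoidalCategory C]
open WalkingParallelPair WalkingParallelPairHom

/-- The span of graphs `(A ⇉ 1) ⟵ (E ⇉ V) ⟶ (B ⇉ 1)`, with source and target maps `s` and `t` and
edge labels `l` and `r`. -/
def bouquetSpan {A B E V : C} (s t : E ⟶ V) (l : E ⟶ A) (r : E ⟶ B) :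
    (⟨bouquet A⟩ : SpanCat (InternalGraph C)) ⟶ ⟨bouquet B⟩ :=
  homMk (X := ⟨bouquet A⟩) (Y := ⟨bouquet B⟩) (parallelPair s t)
    (toBouquet (G := parallelPair s t) l) (toBouquet (G := parallelPair s t) r)

variable {A B D E E' V V' : C} 

theorem bouquetSpan_eq_iff {s t : E ⟶ V} {l : E ⟶ A} {r : E ⟶ B}
    {s' t' : E' ⟶ V'} {l' : E' ⟶ A} {r' : E' ⟶ B} :
    bouquetSpan s t l r = bouquetSpan s' t' l' r' ↔ ∃ (e : E ≅ E') (w : V ≅ V'),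
      s ≫ w.hom = e.hom ≫ s' ∧ t ≫ w.hom = e.hom ≫ t' ∧ e.hom ≫ l' = l ∧ e.hom ≫ r' = r := by
  refine homMk_eq_iff.trans ⟨?_, ?_⟩
  · rintro ⟨i, hl, hr⟩
    exact ⟨i.app zero, i.app one, i.hom.naturality left, i.hom.naturality right,
      congrArg (fun k => k.app zero) hl, congrArg (fun k => k.app zero) hr⟩
  · rintro ⟨e, w, hs, ht, hl, hr⟩
    exact ⟨parallelPairIso s t s' t' e w hs ht, bouquet_hom_ext hl, bouquet_hom_ext hr⟩

/-- Every graph is of the form `E ⇉ V`, so every span between graphs with one vertex is of the form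
`bouquetSpan`. -/
theorem exists_eq_bouquetSpan (f : (⟨bouquet A⟩ : SpanCat (InternalGraph C)) ⟶ ⟨bouquet B⟩) :
    ∃ (E V : C) (s t : E ⟶ V) (l : E ⟶ A) (r : E ⟶ B), f = bouquetSpan s t l r := by
  induction f using hom_ind with
  | h G l r =>
    exact ⟨G.obj zero, G.obj one, G.map left, G.map right, l.app zero, r.app zero,
      homMk_eq (parallelPair.ext (G := parallelPair (G.map left) (G.map right))
        (Iso.refl (G.obj zero)) (Iso.refl (G.obj one))
        ((Category.comp_id _).trans (Category.id_comp _).symm)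
        ((Category.comp_id _).trans (Category.id_comp _).symm))
        (bouquet_hom_ext (Category.id_comp _)) (bouquet_hom_ext (Category.id_comp _))⟩

theorem bouquetSpan_comp {P : C} {s t : E ⟶ V} {l : E ⟶ A} {r : E ⟶ B}
    {s' t' : E' ⟶ V'} {l' : E' ⟶ B} {r' : E' ⟶ D} {p : P ⟶ E} {q : P ⟶ E'}
    (h : IsPullback p q r l') :
    bouquetSpan s t l r ≫ bouquetSpan s' t' l' r' =
      bouquetSpan (lift (p ≫ s) (q ≫ s')) (lift (p ≫ t) (q ≫ t')) (p ≫ l) (q ≫ r') :=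
  (homMk_comp (isPullback_bouquet h)).trans
    (congrArg₂ (homMk _) (bouquet_hom_ext rfl) (bouquet_hom_ext rfl))

/-- The right-hand side keeps the vertices `V`, whereas the product graph has vertices `V ⊗ 1`. -/
theorem bouquetSpan_whiskerRight (s t : E ⟶ V) (l : E ⟶ A) (r : E ⟶ B) (D : C) :
    bouquetSpan s t l r ▷ (⟨bouquet D⟩ : SpanCat (InternalGraph C)) ≫
        graphHom (X := ⟨bouquet B ⊗ bouquet D⟩) (Y := ⟨bouquet (B ⊗ D)⟩) (bouquetTensor B D).hom =
      graphHom (X := ⟨bouquet A ⊗ bouquet D⟩) (Y := ⟨bouquet (A ⊗ D)⟩) (bouquetTensor A D).hom ≫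
        bouquetSpan (fst E D ≫ s) (fst E D ≫ t) (l ▷ D) (r ▷ D) := by
  rw [bouquetSpan, homMk_whiskerRight]
  refine (homMk_graphHom (X := ⟨bouquet A ⊗ bouquet D⟩) (Y := ⟨bouquet B ⊗ bouquet D⟩)
    (Z := ⟨bouquet (B ⊗ D)⟩) _ _ _).trans (Eq.trans ?_ (graphHom_homMk
      (X := ⟨bouquet A ⊗ bouquet D⟩) (Y := ⟨bouquet (A ⊗ D)⟩) (Z := ⟨bouquet (B ⊗ D)⟩)
      (bouquetTensor A D) _ _).symm)
  have hρ : ∀ k : E ⟶ V, (k ⊗ₘ toUnit D) ≫ (ρ_ V).hom = 𝟙 (E ⊗ D) ≫ fst E D ≫ k := fun k => by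
    simp [rightUnitor_hom]
  refine homMk_eq (parallelPair.ext (F := parallelPair s t ⊗ bouquet D)
    (G := parallelPair (fst E D ≫ s) (fst E D ≫ t)) (Iso.refl (E ⊗ D)) (ρ_ V) (hρ s) (hρ t)) ?_ ?_
  · rw [← Category.assoc, Iso.comp_inv_eq]
    exact bouquet_hom_ext ((Category.id_comp (l ▷ D)).trans (Category.comp_id (l ▷ D)).symm)
  · exact bouquet_hom_ext ((Category.id_comp (r ▷ D)).trans (Category.comp_id (r ▷ D)).symm)

end

/-! ### From stateful processes over spans to spans of graphs -/

section
variable {C : Type u} [Category.{v} C] [HasPullbacks C] [CartesianMonoidalCategory C]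
open WalkingParallelPair WalkingParallelPairHom

/-- A span `S ⊗ A ⟵ E ⟶ S ⊗ B`, regarded as a graph `E ⇉ S` over `A ⇉ 1` and `B ⇉ 1`. -/
noncomputable def graphOfSpan (S A B : SpanCat C) : (S ⊗ A ⟶ S ⊗ B) →
    ((⟨bouquet A.obj⟩ : SpanCat (InternalGraph C)) ⟶ ⟨bouquet B.obj⟩) :=
  Quotient.lift (fun P => bouquetSpan (P.l ≫ fst S.obj A.obj) (P.r ≫ fst S.obj B.obj)
    (P.l ≫ snd S.obj A.obj) (P.r ≫ snd S.obj B.obj)) (by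
    rintro P Q ⟨e⟩
    have hl := e.hom.hom_l
    have hr := e.hom.hom_r
    exact bouquetSpan_eq_iff.2 ⟨⟨e.hom.hom, e.inv.hom, hom_inv_apex e, inv_hom_apex e⟩,
      Iso.refl _, by rw [← hl, Iso.refl_hom, Category.comp_id, Category.assoc],
      by rw [← hr, Iso.refl_hom, Category.comp_id, Category.assoc],
      by rw [← hl, Category.assoc], by rw [← hr, Category.assoc]⟩)

theorem graphOfSpan_homMk {S A B : SpanCat C} {E : C} (l : E ⟶ S.obj ⊗ A.obj)
    (r : E ⟶ S.obj ⊗ B.obj) :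
    graphOfSpan S A B (homMk (X := S ⊗ A) (Y := S ⊗ B) E l r) =
      bouquetSpan (l ≫ fst _ _) (r ≫ fst _ _) (l ≫ snd _ _) (r ≫ snd _ _) := rfl

/-- The identification of spans of graphs with one vertex matches the identification of stateful
processes. -/
theorem graphOfSpan_eq_iff {S T A B : SpanCat C} {f : S ⊗ A ⟶ S ⊗ B} {g : T ⊗ A ⟶ T ⊗ B} :
    graphOfSpan S A B f = graphOfSpan T A B g ↔ ∃ h : S ≅ T, f ≫ h.hom ▷ B = h.hom ▷ A ≫ g := by
  induction f using hom_ind with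
  | h E l r => induction g using hom_ind with
    | h F l' r' =>
      have key : ∀ w : S.obj ≅ T.obj,
          homMk (X := S ⊗ A) (Y := S ⊗ B) E l r ≫ (graphHom w.hom : S ⟶ T) ▷ B =
            (graphHom w.hom : S ⟶ T) ▷ A ≫ homMk (X := T ⊗ A) (Y := T ⊗ B) F l' r' ↔
          ∃ e : E ≅ F, e.hom ≫ l' = l ≫ w.hom ▷ A.obj ∧ e.hom ≫ r' = r ≫ w.hom ▷ B.obj := by
        intro w
        have h₁ := homMk_graphHom (X := S ⊗ A) (Y := S ⊗ B) (Z := T ⊗ B) l r (w.hom ▷ B.obj)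
        have h₂ := graphHom_homMk (X := S ⊗ A) (Y := T ⊗ A) (Z := T ⊗ B)
          (whiskerRightIso w A.obj) l' r'
        rw [graphHom_whiskerRight, graphHom_whiskerRight]
        rw [whiskerRightIso_hom] at h₂
        rw [h₁, h₂, homMk_eq_iff]
        refine exists_congr fun e => and_congr_left fun _ => ?_
        rw [← Category.assoc, Iso.comp_inv_eq]
        rfl
      change bouquetSpan (l ≫ fst S.obj A.obj) (r ≫ fst S.obj B.obj) (l ≫ snd S.obj A.obj)
        (r ≫ snd S.obj B.obj) = bouquetSpan (l' ≫ fst T.obj A.obj) (r' ≫ fst T.obj B.obj)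
        (l' ≫ snd T.obj A.obj) (r' ≫ snd T.obj B.obj) ↔ _
      constructor
      · intro h
        obtain ⟨e, w, hs, ht, hl, hr⟩ := bouquetSpan_eq_iff.1 h
        refine ⟨graphIso w, (key w).2 ⟨e, ?_, ?_⟩⟩
        · apply CartesianMonoidalCategory.hom_ext
          · simpa using hs.symm
          · simpa using hl
        · apply CartesianMonoidalCategory.hom_ext
          · simpa using ht.symm
          · simpa using hr
      · rintro ⟨h, e⟩
        obtain ⟨w, hw⟩ := exists_graphHom_eq_hom h
        rw [hw] at e
        obtain ⟨i, hl, hr⟩ := (key w).1 e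
        refine bouquetSpan_eq_iff.2 ⟨i, w, ?_, ?_, ?_, ?_⟩
        · simpa using hl.symm =≫ fst _ _
        · simpa using hr.symm =≫ fst _ _
        · simpa using hl =≫ snd _ _
        · simpa using hr =≫ snd _ _

end
end SpanCat

namespace St
open SpanCat WalkingParallelPair WalkingParallelPairHom

variable {C : Type u} [Category.{v} C] [HasPullbacks C] [CartesianMonoidalCategory C]

/-- The span of graphs with one vertex given by a stateful process over spans: the state space is
the object of vertices. -/
noncomputable def graphMap {A B : St (SpanCat C)} : (A ⟶ B) →
    ((⟨bouquet A.obj.obj⟩ : SpanCat (InternalGraph C)) ⟶ ⟨bouquet B.obj.obj⟩) :=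
  Quotient.lift (fun P => graphOfSpan P.state A.obj B.obj P.hom) (by
    rintro ⟨S, f⟩ ⟨T, g⟩ h
    exact graphOfSpan_eq_iff.2 (StProc.exists_iso h))

theorem graphMap_homMk {A B : St (SpanCat C)} {S : SpanCat C} (f : S ⊗ A.obj ⟶ S ⊗ B.obj) :
    graphMap (homMk S f : A ⟶ B) = graphOfSpan S A.obj B.obj f := rfl

/-- Morphisms of the base, and with them all structure isomorphisms, are sent to morphisms of
graphs. -/
theorem graphMap_pureHom_graphHom {A B : St (SpanCat C)} (u : A.obj.obj ⟶ B.obj.obj) :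
    graphMap (pureHom (graphHom u) : A ⟶ B) =
      SpanCat.graphHom (X := ⟨bouquet A.obj.obj⟩) (Y := ⟨bouquet B.obj.obj⟩) (bouquetMap u) := by
  rw [pureHom, graphMap_homMk, whiskerLeft_graphHom]
  refine Eq.trans (graphOfSpan_homMk (S := 𝟙_ (SpanCat C)) (A := A.obj) (B := B.obj) _ _) ?_
  refine Eq.trans (bouquetSpan_eq_iff (s' := toUnit A.obj.obj) (t' := toUnit A.obj.obj)
    (l' := 𝟙 _) (r' := u).2 ⟨λ_ A.obj.obj, Iso.refl _, toUnit_unique _ _, toUnit_unique _ _,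
      ?_, ?_⟩) ?_
  · change _ = 𝟙 (𝟙_ C ⊗ A.obj.obj) ≫ snd (𝟙_ C) A.obj.obj
    simp [leftUnitor_hom]
  · change _ = (𝟙_ C ◁ u) ≫ snd (𝟙_ C) B.obj.obj
    simp [leftUnitor_hom]
  · exact congrArg₂ (SpanCat.homMk _) (bouquet_hom_ext rfl) rfl

/-- Stateful processes over spans, as spans of graphs. -/
noncomputable def graphFunctor (C : Type u) [Category.{v} C] [HasPullbacks C]
    [CartesianMonoidalCategory C] :
    St (SpanCat C) ⥤ SpanCat (InternalGraph C) where
  obj A := ⟨bouquet A.obj.obj⟩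
  map := graphMap
  map_id A := by
    rw [← pureHom_id, ← graphHom_id, graphMap_pureHom_graphHom, ← graphHom_id]
    exact congrArg SpanCat.graphHom (bouquet_hom_ext rfl)
  map_comp {X Y Z} f g := by
    induction f using hom_ind with
    | h S f => induction g using hom_ind with
      | h T g => induction f using SpanCat.hom_ind with
        | h E l r => induction g using SpanCat.hom_ind with
          | h F l' r' =>
            have h := IsPullback.of_hasPullback (r ≫ snd S.obj Y.obj.obj) (l' ≫ snd T.obj Y.obj.obj)
            rw [homMk_comp, graphMap_homMk, graphMap_homMk, graphMap_homMk, compHom_homMk h]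
            refine Eq.trans ?_ (bouquetSpan_comp (s := l ≫ fst S.obj X.obj.obj)
              (t := r ≫ fst S.obj Y.obj.obj) (l := l ≫ snd S.obj X.obj.obj)
              (s' := l' ≫ fst T.obj Y.obj.obj) (t' := r' ≫ fst T.obj Z.obj.obj)
              (r' := r' ≫ snd T.obj Z.obj.obj) h).symm
            refine (graphOfSpan_homMk (S := S ⊗ T) (A := X.obj) (B := Z.obj) _ _).trans ?_
            congr 1
            · exact lift_fst _ _
            · exact lift_fst _ _
            · exact lift_snd _ _
            · exact lift_snd _ _

instance : (graphFunctor C).Faithful where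
  map_injective {A B} f g h := by
    induction f using hom_ind with
    | h S f => induction g using hom_ind with
      | h T g =>
        obtain ⟨w, e⟩ := graphOfSpan_eq_iff.1 h
        exact homMk_eq w e

instance : (graphFunctor C).Full where
  map_surjective {A B} f := by
    obtain ⟨E, V, s, t, l, r, rfl⟩ := exists_eq_bouquetSpan f
    refine ⟨homMk ⟨V⟩ (SpanCat.homMk (X := ⟨V⟩ ⊗ A.obj) (Y := ⟨V⟩ ⊗ B.obj) E (lift s l) (lift t r)),
      ?_⟩
    refine (graphOfSpan_homMk (S := ⟨V⟩) (A := A.obj) (B := B.obj) _ _).trans ?_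
    rw [lift_fst, lift_fst, lift_snd, lift_snd]

theorem graphMap_whiskerRight {A B : St (SpanCat C)} {S : SpanCat C} {E : C}
    (l : E ⟶ S.obj ⊗ A.obj.obj) (r : E ⟶ S.obj ⊗ B.obj.obj) (Z : St (SpanCat C)) :
    graphMap ((homMk S (SpanCat.homMk (X := S ⊗ A.obj) (Y := S ⊗ B.obj) E l r) : A ⟶ B) ▷ Z) =
      bouquetSpan (fst E Z.obj.obj ≫ l ≫ fst _ _) (fst E Z.obj.obj ≫ r ≫ fst _ _)
        ((l ≫ snd _ _) ▷ Z.obj.obj) ((r ≫ snd _ _) ▷ Z.obj.obj) := by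
  have h : (α_ S A.obj Z.obj).inv ≫ SpanCat.homMk (X := S ⊗ A.obj) (Y := S ⊗ B.obj) E l r ▷ Z.obj ≫
      (α_ S B.obj Z.obj).hom = SpanCat.homMk (X := S ⊗ A.obj ⊗ Z.obj) (Y := S ⊗ B.obj ⊗ Z.obj)
        (E ⊗ Z.obj.obj) (l ▷ Z.obj.obj ≫ (α_ _ _ _).hom) (r ▷ Z.obj.obj ≫ (α_ _ _ _).hom) := by
    rw [SpanCat.homMk_whiskerRight]
    exact graphHom_comp_homMk_comp_graphHom (X := S ⊗ A.obj ⊗ Z.obj) (Y := (S ⊗ A.obj) ⊗ Z.obj)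
      (Z := (S ⊗ B.obj) ⊗ Z.obj) (W := S ⊗ B.obj ⊗ Z.obj)
      (α_ S.obj A.obj.obj Z.obj.obj).symm _ _ _
  rw [homMk_whiskerRight, h]
  refine (graphOfSpan_homMk (S := S) (A := A.obj ⊗ Z.obj) (B := B.obj ⊗ Z.obj) _ _).trans ?_
  have h₁ : ∀ (X : C) (k : E ⟶ S.obj ⊗ X), (k ▷ Z.obj.obj ≫ (α_ _ _ _).hom) ≫ fst _ _ =
      fst E Z.obj.obj ≫ k ≫ fst _ _ := fun X k => by simp
  have h₂ : ∀ (X : C) (k : E ⟶ S.obj ⊗ X), (k ▷ Z.obj.obj ≫ (α_ _ _ _).hom) ≫ snd _ _ =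
      (k ≫ snd _ _) ▷ Z.obj.obj := fun X k => by
    ext <;> simp
  congr 1
  · exact h₁ _ l
  · exact h₁ _ r
  · exact h₂ _ l
  · exact h₂ _ r

/-- The passage from stateful processes over spans to spans of graphs is symmetric monoidal, because
a product of graphs with one vertex has one vertex. -/
noncomputable instance : (graphFunctor C).Braided :=
  .ofNaturalLeft _
    (graphIso (X := 𝟙_ (SpanCat (InternalGraph C))) (Y := ⟨bouquet (𝟙_ C)⟩) (bouquetUnit C))
    (fun A B => graphIso (X := ⟨bouquet A.obj.obj ⊗ bouquet B.obj.obj⟩)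
      (Y := ⟨bouquet (A.obj.obj ⊗ B.obj.obj)⟩) (bouquetTensor A.obj.obj B.obj.obj))
    (by
      intro X Y f Z
      induction f using hom_ind with
      | h S f => induction f using SpanCat.hom_ind with
        | h E l r =>
          exact (bouquetSpan_whiskerRight (l ≫ fst S.obj X.obj.obj) (r ≫ fst S.obj Y.obj.obj)
            (l ≫ snd S.obj X.obj.obj) (r ≫ snd S.obj Y.obj.obj) Z.obj.obj).trans
            (congrArg (fun a => SpanCat.graphHom (X := ⟨bouquet X.obj.obj ⊗ bouquet Z.obj.obj⟩)
              (Y := ⟨bouquet (X.obj.obj ⊗ Z.obj.obj)⟩)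
              (bouquetTensor X.obj.obj Z.obj.obj).hom ≫ a) (graphMap_whiskerRight l r Z).symm))
    (by
      intro X Y Z
      have h := congrArg (SpanCat.graphHom
        (X := ⟨(bouquet X.obj.obj ⊗ bouquet Y.obj.obj) ⊗ bouquet Z.obj.obj⟩)
        (Y := ⟨bouquet (X.obj.obj ⊗ Y.obj.obj ⊗ Z.obj.obj)⟩))
        (show (bouquetTensor X.obj.obj Y.obj.obj).hom ▷ bouquet Z.obj.obj ≫
          (bouquetTensor (X.obj.obj ⊗ Y.obj.obj) Z.obj.obj).hom ≫
            bouquetMap (α_ X.obj.obj Y.obj.obj Z.obj.obj).hom =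
          (α_ (bouquet X.obj.obj) (bouquet Y.obj.obj) (bouquet Z.obj.obj)).hom ≫
            bouquet X.obj.obj ◁ (bouquetTensor Y.obj.obj Z.obj.obj).hom ≫
              (bouquetTensor X.obj.obj (Y.obj.obj ⊗ Z.obj.obj)).hom from bouquet_hom_ext (by
          change 𝟙 (X.obj.obj ⊗ Y.obj.obj) ▷ Z.obj.obj ≫ 𝟙 _ ≫
            (α_ X.obj.obj Y.obj.obj Z.obj.obj).hom = (α_ X.obj.obj Y.obj.obj Z.obj.obj).hom ≫
            X.obj.obj ◁ 𝟙 (Y.obj.obj ⊗ Z.obj.obj) ≫ 𝟙 _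
          simp))
      rw [SpanCat.graphHom_comp (Y := ⟨bouquet (X.obj.obj ⊗ Y.obj.obj) ⊗ bouquet Z.obj.obj⟩),
        SpanCat.graphHom_comp (Y := ⟨bouquet ((X.obj.obj ⊗ Y.obj.obj) ⊗ Z.obj.obj)⟩),
        SpanCat.graphHom_comp (Y := ⟨bouquet X.obj.obj ⊗ bouquet Y.obj.obj ⊗ bouquet Z.obj.obj⟩),
        SpanCat.graphHom_comp (Y := ⟨bouquet X.obj.obj ⊗ bouquet (Y.obj.obj ⊗ Z.obj.obj)⟩)] at h
      have e₁ := graphHom_whiskerRight (Y := ⟨bouquet X.obj.obj ⊗ bouquet Y.obj.obj⟩)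
        (Z := ⟨bouquet (X.obj.obj ⊗ Y.obj.obj)⟩) (bouquetTensor X.obj.obj Y.obj.obj).hom
        ⟨bouquet Z.obj.obj⟩
      have e₂ := whiskerLeft_graphHom ⟨bouquet X.obj.obj⟩
        (Y := ⟨bouquet Y.obj.obj ⊗ bouquet Z.obj.obj⟩)
        (Z := ⟨bouquet (Y.obj.obj ⊗ Z.obj.obj)⟩) (bouquetTensor Y.obj.obj Z.obj.obj).hom
      have e₃ := graphMap_pureHom_graphHom (A := (X ⊗ Y) ⊗ Z) (B := X ⊗ Y ⊗ Z)
        (α_ X.obj.obj Y.obj.obj Z.obj.obj).hom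
      refine (congrArg₂ (fun a b => a ≫ SpanCat.graphHom (bouquetTensor _ _).hom ≫ b) e₁ e₃).trans
        (h.trans ?_)
      exact congrArg (fun a => (α_ (⟨bouquet X.obj.obj⟩ : SpanCat (InternalGraph C))
        ⟨bouquet Y.obj.obj⟩ ⟨bouquet Z.obj.obj⟩).hom ≫ a ≫ SpanCat.graphHom
          (X := ⟨bouquet X.obj.obj ⊗ bouquet (Y.obj.obj ⊗ Z.obj.obj)⟩)
          (Y := ⟨bouquet (X.obj.obj ⊗ Y.obj.obj ⊗ Z.obj.obj)⟩) (bouquetTensor _ _).hom) e₂.symm)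
    (by
      intro X
      have h := congrArg (SpanCat.graphHom (X := ⟨𝟙_ (InternalGraph C) ⊗ bouquet X.obj.obj⟩)
        (Y := ⟨bouquet X.obj.obj⟩))
        (show (λ_ (bouquet X.obj.obj)).hom = (bouquetUnit C).hom ▷ bouquet X.obj.obj ≫
          (bouquetTensor (𝟙_ C) X.obj.obj).hom ≫ bouquetMap (λ_ X.obj.obj).hom from
        bouquet_hom_ext (by
          change (λ_ X.obj.obj).hom = 𝟙 (𝟙_ C) ▷ X.obj.obj ≫ 𝟙 _ ≫ (λ_ X.obj.obj).hom
          simp))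
      rw [SpanCat.graphHom_comp (Y := ⟨bouquet (𝟙_ C) ⊗ bouquet X.obj.obj⟩),
        SpanCat.graphHom_comp (Y := ⟨bouquet (𝟙_ C ⊗ X.obj.obj)⟩)] at h
      have e₁ := graphHom_whiskerRight (Y := 𝟙_ (SpanCat (InternalGraph C)))
        (Z := ⟨bouquet (𝟙_ C)⟩) (bouquetUnit C).hom ⟨bouquet X.obj.obj⟩
      have e₂ := graphMap_pureHom_graphHom (A := 𝟙_ (St (SpanCat C)) ⊗ X) (B := X)
        (λ_ X.obj.obj).hom
      exact h.trans (congrArg₂ (fun a b => a ≫ SpanCat.graphHom (bouquetTensor _ _).hom ≫ b)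
        e₁ e₂).symm)
    (by
      intro X Y
      have h := congrArg (SpanCat.graphHom (X := ⟨bouquet X.obj.obj ⊗ bouquet Y.obj.obj⟩)
        (Y := ⟨bouquet (Y.obj.obj ⊗ X.obj.obj)⟩))
        (show (bouquetTensor X.obj.obj Y.obj.obj).hom ≫ bouquetMap (swap X.obj.obj Y.obj.obj).hom =
          (swap (bouquet X.obj.obj) (bouquet Y.obj.obj)).hom ≫
            (bouquetTensor Y.obj.obj X.obj.obj).hom from bouquet_hom_ext (by
          change 𝟙 _ ≫ (swap X.obj.obj Y.obj.obj).hom = (lift (snd (bouquet X.obj.obj)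
            (bouquet Y.obj.obj)) (fst (bouquet X.obj.obj) (bouquet Y.obj.obj))).app zero ≫ 𝟙 _
          rw [Category.id_comp, Category.comp_id]
          apply CartesianMonoidalCategory.hom_ext
          · exact (lift_fst _ _).trans (congrArg (fun k => k.app zero) (lift_fst
              (snd (bouquet X.obj.obj) (bouquet Y.obj.obj))
              (fst (bouquet X.obj.obj) (bouquet Y.obj.obj)))).symm
          · exact (lift_snd _ _).trans (congrArg (fun k => k.app zero) (lift_snd
              (snd (bouquet X.obj.obj) (bouquet Y.obj.obj))
              (fst (bouquet X.obj.obj) (bouquet Y.obj.obj)))).symm))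
      rw [SpanCat.graphHom_comp (Y := ⟨bouquet (X.obj.obj ⊗ Y.obj.obj)⟩),
        SpanCat.graphHom_comp (Y := ⟨bouquet Y.obj.obj ⊗ bouquet X.obj.obj⟩)] at h
      have e := graphMap_pureHom_graphHom (A := X ⊗ Y) (B := Y ⊗ X) (swap X.obj.obj Y.obj.obj).hom
      exact (congrArg (fun a => SpanCat.graphHom (bouquetTensor _ _).hom ≫ a) e).trans h)

end St

theorem isBouquet_graphFunctor {C : Type u} [Category.{v} C] [HasPullbacks C]
    [CartesianMonoidalCategory C] (A : St (SpanCat C)) : isBouquet C ((St.graphFunctor C).obj A) :=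
  ⟨A.obj.obj, rfl⟩

theorem mainTheorem2 {C : Type u} [Category.{v} C] [HasFiniteLimits C]
    [CartesianMonoidalCategory C] :
    (∃ K : St (SpanCat C) ⥤ SpanGraphStar C,
      (∀ A : C, (K.obj ⟨⟨A⟩⟩).obj.obj = bouquet A) ∧
      K.Full ∧ K.Faithful ∧ Function.Bijective K.obj ∧
      Nonempty (K ⋙ (isBouquet C).ι).Braided) ∧
    (∃ φ : FeedbackStructure (St (SpanCat C)),
      (∀ (T A B : St (SpanCat C)) (f : T ⊗ A ⟶ T ⊗ B), φ.fbk T f = St.store T f) ∧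
      IsFreeFeedbackCategory.{_, _, v₃, _, _, u₃} φ (St.inclusion (SpanCat C))) := by
  refine ⟨⟨(isBouquet C).lift (St.graphFunctor C) isBouquet_graphFunctor, fun _ => rfl,
    inferInstance, inferInstance, ⟨?_, ?_⟩, ⟨inferInstanceAs (St.graphFunctor C).Braided⟩⟩,
    St.feedback (SpanCat C), fun _ _ _ _ => rfl, St.isFreeFeedbackCategory (SpanCat C)⟩
  · rintro ⟨⟨A⟩⟩ ⟨⟨B⟩⟩ h
    have h' : bouquet A = bouquet B := congrArg (fun G : SpanGraphStar C => G.obj.obj) h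
    have h'' : A = B := congrArg (fun G : InternalGraph C => G.obj .zero) h'
    rw [h'']
  · rintro ⟨⟨G⟩, A, h⟩
    obtain rfl : G = bouquet A := h
    exact ⟨⟨⟨A⟩⟩, rfl⟩
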